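/- Let $n\ge 2$, $j\ge 1$ be integers, $\lambda=\frac{n-1}{2}$, and let $\sigma$ be the surface measure on the unit sphere $\mathcal S^n\subset\mathbb R^{n+1}$, of total mass $\Sigma_n=\frac{2\pi^{\lambda+1}}{\Gamma(\lambda+1)}$. Put $\langle f,g\rangle=\frac1{\Sigma_n}\int_{\mathcal S^n}\overline{f}\,g\,d\sigma$ and $\|f\|=\langle f,f\rangle^{1/2}$. Let $\mathcal H_l$ be the space of restrictions to $\mathcal S^n$ of complex homogeneous harmonic polynomials of degree $l$ on $\mathbb R^{n+1}$, let $\mathcal V_j=\bigoplus_{l=0}^{2^{j-1}-1}\mathcal H_l$, let $C_l^\lambda$ be the Gegenbauer polynomials, and $$\varphi_j=2^{-nj/2}\sum_{l=0}^{2^{j-1}-1}\frac{l+\lambda}{\lambda}\,C_l^\lambda .$$ Use spherical coordinates $x_\nu=\sin\vartheta_1\cdots\sin\vartheta_{\nu-1}\cos\vartheta_\nu$ $(1\le\nu\le n-1)$, $x_n=\sin\vartheta_1\cdots\sin\vartheta_{n-1}\cos\varphi$, $x_{n+1}=\sin\vartheta_1\cdots\sin\vartheta_{n-1}\sin\varphi$.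 For integers $l=k_0\ge k_1\ge\dots\ge k_{n-2}\ge|k_{n-1}|$ let $$Y_l^k=A_l^k\prod_{\nu=1}^{n-1}C_{k_{\nu-1}-|k_\nu|}^{\frac{n-\nu}2+|k_\nu|}(\cos\vartheta_\nu)\,\sin^{|k_\nu|}\vartheta_\nu\; e^{ik_{n-1}\varphi},\qquad A_l^k>0,\ \|Y_l^k\|=1,$$ and $a_l^k(f)=\langle Y_l^k,f\rangle$. Let $\mathcal N_j=\{(s,t):\ s\in\{0,\dots,2^j\}^{n-1},\ t\in\{0,\dots,2^{j+1}-1\}\}$, let $x_{s,t}^j$ be the point with spherical coordinates $\left(\frac{s_1\pi}{2^j},\dots,\frac{s_{n-1}\pi}{2^j},\frac{t\pi}{2^j}\right)$, and let $w_{s}^{j}=\prod_{\nu=1}^{n-1}\chi_{s_\nu}^{(j)}$, where, with $M=2^j$, $\alpha=n-\nu$, $\epsilon_0=\epsilon_M=\frac12$ and $\epsilon_u=1$ otherwise, $$\chi_{u}^{(j)}=\epsilon_u\,\frac{\pi\,\alpha!}{2^{\alpha-1}M}\sum_{\mu=0}^{M/2}\frac{\epsilon_{2\mu}(-1)^\mu\cos\frac{2\mu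 u\pi}{M}}{\Gamma(\frac\alpha2-\mu+1)\,\Gamma(\frac\alpha2+\mu+1)}$$ (summands with $\frac\alpha2-\mu+1\in\{0,-1,-2,\dots\}$ are $0$). Then for every $(s,t)\in\mathcal N_j$, writing $\varphi_j(\circ\cdot y)$ for the function $x\mapsto\varphi_j(x\cdot y)$ on $\mathcal S^n$: 0. If for every $l$ the family $(Z_l^\kappa)_{\kappa}$ is an orthonormal basis of $\mathcal H_l$, then $\varphi_j(\circ\cdot x_{s,t}^j)=2^{-nj/2}\sum_{l<2^{j-1}}\sum_\kappa\overline{Z_l^\kappa(x_{s,t}^j)}\,Z_l^\kappa$. 1. $\varphi_j(\circ\cdot x_{s,t}^j)$ is real-valued. 2. $\langle\varphi_j(\circ\cdot x_{s,t}^j),f\rangle=2^{-nj/2}f(x_{s,t}^j)$ for all $f\in\mathcal V_j$. 3. $\displaystyle\|\varphi_j(\circ\cdot x_{s,t}^j)\|^2=2^{-nj/2}\varphi_j(1)=\frac{(n+2^j-2)\,(n+2^{j-1}-2)!}{2^{nj}\,n!\,(2^{j-1}-1)!}$. 4. $\displaystyle\frac{\|\varphi_j(\circ\cdot x_{s,t}^j)\|}{\varphi_j(x_{s,t}^j\cdot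 x_{s,t}^j)}=\min\{\|f\|:\ f\in\mathcal V_j,\ f(x_{s,t}^j)=1\}$. 5. $\operatorname{span}\{\varphi_j(\circ\cdot x_{s,t}^j):(s,t)\in\mathcal N_j\}=\mathcal V_j$, and for all $f\in\mathcal V_j$ $$f=\frac{2^{j(n-2)/2}\,\pi}{\Sigma_n}\sum_{(s,t)\in\mathcal N_j}w_s^j\,f(x_{s,t}^j)\,\varphi_j(\circ\cdot x_{s,t}^j).$$ 6. For all $f\in\mathcal V_j$ $$\frac{2^{(n-1)j}\,\pi}{\Sigma_n}\sum_{(s,t)\in\mathcal N_j}w_s^j\,\bigl|\langle f,\varphi_j(\circ\cdot x_{s,t}^j)\rangle\bigr|^2=\|f\|^2 .$$ If all weights $w_s^j$ are non-negative, which is always so for $n\le3$, then the family $\bigl((w_s^j)^{1/2}\varphi_j(\circ\cdot x_{s,t}^j)\bigr)_{(s,t)\in\mathcal N_j}$ is a tight frame in $\mathcal V_j$, with frame constant $\Sigma_n/(2^{(n-1)j}\pi)$. 7. For all indices $(l,k)$: $a_l^k(\varphi_j(\circ\cdot x_{s,t}^j))=2^{-nj/2}\,\overline{Y_l^k(x_{s,t}^j)}$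 if $l<2^{j-1}$ and $0$ otherwise; and $a_l^k(\varphi_j(\circ\cdot x_{s,t}^j))=2^{n/2}\,a_l^k(\varphi_{j+1}(\circ\cdot x_{s,t}^j))$ if $l<2^{j-1}$ and $0$ otherwise. 8. $\displaystyle\int_{\mathcal S^n}\varphi_j(x\cdot x_{s,t}^j)\,d\sigma(x)=\frac{2^{3-n(1+\frac j2)}\,\pi^{\frac n2+1}\,\Gamma(2\lambda)}{\Gamma(\lambda)\,\Gamma(\lambda+\frac12)\,\Gamma(\lambda+1)}$. -/

import Mathlib

open MeasureTheory

noncomputable section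

namespace SphereWavelet

/-! ### The sphere, its measure and the scalar product -/

/-- The unit sphere `S^n` in the Euclidean space `ℝ^(n+1)`. -/
abbrev Sph (n : ℕ) : Type := Metric.sphere (0 : EuclideanSpace ℝ (Fin (n + 1))) 1

/-- The (non-normalized) surface measure `σ` on `S^n`. -/
def sigma (n : ℕ) : Measure (Sph n) :=
  (volume : Measure (EuclideanSpace ℝ (Fin (n + 1)))).toSphere

/-- The parameter `λ = (n - 1) / 2`. -/
def lam (n : ℕ) : ℝ := ((n : ℝ) - 1) / 2

/-- The total surface measure `Σ_n = 2 π^(λ+1) / Γ(λ+1)` of `S^n`. -/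
def sphereArea (n : ℕ) : ℝ := 2 * Real.pi ^ (lam n + 1) / Real.Gamma (lam n + 1)

/-- `Σ_n` is indeed the total mass of `σ`. -/
theorem sigma_real_univ (n : ℕ) : (sigma n).real Set.univ = sphereArea n := by
  have hpi := Real.pi_pos
  have hd : (0 : ℝ) < ((n : ℝ) + 1) / 2 := by positivity
  rw [sigma, Measure.toSphere_real_apply_univ, Measure.real, EuclideanSpace.volume_ball,
    finrank_euclideanSpace, Fintype.card_fin, ENNReal.ofReal_one, one_pow, one_mul,
    ENNReal.toReal_ofReal (by positivity), sphereArea]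
  have h1 : lam n + 1 = ((n : ℝ) + 1) / 2 := by unfold lam; ring
  have h2 : Real.sqrt Real.pi ^ (n + 1) = Real.pi ^ (((n : ℝ) + 1) / 2) := by
    rw [Real.sqrt_eq_rpow, ← Real.rpow_natCast, ← Real.rpow_mul hpi.le]
    congr 1
    push_cast
    ring
  have hG := Real.Gamma_pos_of_pos hd
  rw [h1, h2]
  push_cast
  rw [Real.Gamma_add_one hd.ne']
  field_simp

/-- The scalar product `⟨f, g⟩ = (1/Σ_n) ∫ conj(f) g dσ`, conjugate-linear in the first slot. -/
def sInner (n : ℕ) (f g : Sph n → ℂ) : ℂ :=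
  ((sphereArea n)⁻¹ : ℝ) * ∫ x, (starRingEnd ℂ) (f x) * g x ∂(sigma n)

/-- The norm `‖f‖ = ⟨f, f⟩^(1/2)`. -/
def sNorm (n : ℕ) (f : Sph n → ℂ) : ℝ := Real.sqrt (sInner n f f).re

/-! ### Hyperspherical harmonics -/

/-- The Laplace operator on (complex-valued) polynomials on `ℝ^(n+1)`. -/
def laplacian (n : ℕ) :
    MvPolynomial (Fin (n + 1)) ℂ →ₗ[ℂ] MvPolynomial (Fin (n + 1)) ℂ :=
  ∑ i : Fin (n + 1), (MvPolynomial.pderiv i).toLinearMap ∘ₗ (MvPolynomial.pderiv i).toLinearMap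

/-- Restriction of a polynomial on `ℝ^(n+1)` to the sphere `S^n`. -/
def restrictSphere (n : ℕ) : MvPolynomial (Fin (n + 1)) ℂ →ₗ[ℂ] (Sph n → ℂ) :=
  LinearMap.pi fun x =>
    (MvPolynomial.aeval fun i : Fin (n + 1) => ((x.1 i : ℝ) : ℂ)).toLinearMap

/-- `H_l`: restrictions to `S^n` of the homogeneous harmonic polynomials of degree `l`. -/
def harmonics (n l : ℕ) : Submodule ℂ (Sph n → ℂ) :=
  (MvPolynomial.homogeneousSubmodule (Fin (n + 1)) ℂ l ⊓
    LinearMap.ker (laplacian n)).map (restrictSphere n)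

/-- The sampling space `V_j`, the sum of the `H_l` over `l ≤ 2^(j-1) - 1`. -/
def samplingSpace (n j : ℕ) : Submodule ℂ (Sph n → ℂ) :=
  ⨆ l ∈ Finset.range (2 ^ (j - 1)), harmonics n l

/-- The Gegenbauer polynomial `C_l^μ(t)`, in its explicit form. -/
def gegenbauer (μ : ℝ) (l : ℕ) (t : ℝ) : ℝ :=
  ∑ k ∈ Finset.range (l / 2 + 1),
    (-1) ^ k * (ascPochhammer ℝ (l - k)).eval μ /
      ((k.factorial : ℝ) * ((l - 2 * k).factorial : ℝ)) * (2 * t) ^ (l - 2 * k)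

/-! ### Spherical coordinates and the standard basis of hyperspherical harmonics -/

/-- The Cartesian coordinates of the point with spherical coordinates
`(θ 0, …, θ (n-1)) = (ϑ_1, …, ϑ_{n-1}, φ)`. -/
def sphCoord (n : ℕ) (θ : ℕ → ℝ) (i : ℕ) : ℝ :=
  (∏ m ∈ Finset.range i, Real.sin (θ m)) * if i < n then Real.cos (θ i) else 1

theorem sphCoord_sq_sum (n : ℕ) (θ : ℕ → ℝ) :
    ∑ i ∈ Finset.range (n + 1), sphCoord n θ i ^ 2 = 1 := by
  have key : ∀ m, m ≤ n → ∑ i ∈ Finset.range m, sphCoord n θ i ^ 2 +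
      (∏ i ∈ Finset.range m, Real.sin (θ i)) ^ 2 = 1 := by
    intro m
    induction m with
    | zero => simp
    | succ m ih =>
      intro hm
      have := ih (by omega)
      rw [Finset.sum_range_succ, Finset.prod_range_succ, sphCoord,
        if_pos (show m < n by omega)]
      nlinarith [Real.sin_sq_add_cos_sq (θ m)]
  rw [Finset.sum_range_succ, sphCoord]
  simpa using key n le_rfl

/-- The point of `S^n` with spherical coordinates `(ϑ_1, …, ϑ_{n-1}, φ)`. -/
def sphPoint (n : ℕ) (θ : ℕ → ℝ) : Sph n :=
  ⟨WithLp.toLp 2 fun i : Fin (n + 1) => sphCoord n θ i, by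
    rw [mem_sphere_zero_iff_norm, EuclideanSpace.norm_eq]
    have h := sphCoord_sq_sum n θ
    rw [← Fin.sum_univ_eq_sum_range (fun i => sphCoord n θ i ^ 2)] at h
    simp [h]⟩

/-- The polar angle `ϑ_{i+1} ∈ [0, π]` of a point `x` of `S^n`, for `i < n - 1`. Where all of
the coordinates from `i` on vanish it is indeterminate, and the value `π / 2` is taken. -/
def polarAngle (n : ℕ) (x : Sph n) (i : Fin (n - 1)) : ℝ :=
  Real.arccos (x.1 ⟨i, by omega⟩ /
    Real.sqrt (∑ m : Fin (n + 1), if (i : ℕ) ≤ (m : ℕ) then x.1 m ^ 2 else 0))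

/-- The azimuth `φ` (modulo `2π`) of a point `x` of `S^n`. -/
def azimuth (n : ℕ) (x : Sph n) : ℝ :=
  Complex.arg ⟨x.1 ⟨n - 1, by omega⟩, x.1 ⟨n, by omega⟩⟩

/-- The indices `(l, k)`, written as `k = (k_0, …, k_{n-1})` with `l = k_0` and
`k_0 ≥ k_1 ≥ … ≥ k_{n-2} ≥ |k_{n-1}|`; the last entry carries the sign of the exponent. -/
def HarmonicIndex (n : ℕ) : Type :=
  {k : Fin n → ℤ // ∀ a b : Fin n, a < b → |k b| ≤ k a}

/-- The degree `l = k_0` of an index. -/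
def HarmonicIndex.degree {n : ℕ} (hn : 2 ≤ n) (k : HarmonicIndex n) : ℕ :=
  (k.1 ⟨0, by omega⟩).toNat

/-- The function
`∏_{ν=1}^{n-1} C_{k_{ν-1}-|k_ν|}^{(n-ν)/2+|k_ν|}(cos ϑ_ν) sin^{|k_ν|} ϑ_ν · e^{i k_{n-1} φ}`
(here `ν = i + 1`). -/
def harmonicRaw (n : ℕ) (hn : 2 ≤ n) (k : HarmonicIndex n) (x : Sph n) : ℂ :=
  ((∏ i : Fin (n - 1),
      (gegenbauer (((n : ℝ) - 1 - (i : ℕ)) / 2 + (k.1 ⟨i + 1, by omega⟩).natAbs)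
          (k.1 ⟨i, by omega⟩ - |k.1 ⟨i + 1, by omega⟩|).toNat
          (Real.cos (polarAngle n x i)) *
        Real.sin (polarAngle n x i) ^ (k.1 ⟨i + 1, by omega⟩).natAbs) : ℝ) : ℂ) *
    Complex.exp (Complex.I * (k.1 ⟨n - 1, by omega⟩ : ℂ) * (azimuth n x : ℂ))

/-- The hyperspherical harmonic `Y_l^k`, normalized in `L^2(S^n)`. -/
def harmonicY (n : ℕ) (hn : 2 ≤ n) (k : HarmonicIndex n) (x : Sph n) : ℂ :=
  ((sNorm n (harmonicRaw n hn k))⁻¹ : ℝ) * harmonicRaw n hn k x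

/-- The Fourier coefficient `a_l^k(f) = ⟨Y_l^k, f⟩`. -/
def harmonicCoeff (n : ℕ) (hn : 2 ≤ n) (k : HarmonicIndex n) (f : Sph n → ℂ) : ℂ :=
  sInner n (harmonicY n hn k) f

/-! ### Nodes and weights -/

/-- The index set `N_j` of the grid: `s_1, …, s_{n-1} ∈ {0, …, 2^j}`, `t ∈ {0, …, 2^(j+1) - 1}`. -/
abbrev NodeIndex (n j : ℕ) : Type := (Fin (n - 1) → Fin (2 ^ j + 1)) × Fin (2 ^ (j + 1))

/-- The node `x_{s,t}^j`, with spherical coordinates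
`(s_1 π / 2^j, …, s_{n-1} π / 2^j, t π / 2^j)`. -/
def node (n j : ℕ) (p : NodeIndex n j) : Sph n :=
  sphPoint n fun i =>
    if h : i < n - 1 then ((p.1 ⟨i, h⟩ : ℕ) : ℝ) * Real.pi / 2 ^ j
    else ((p.2 : ℕ) : ℝ) * Real.pi / 2 ^ j

/-- The end-point factors: `ε_0 = ε_M = 1/2`, and `ε_u = 1` otherwise. -/
def quadEps (M u : ℕ) : ℝ := if u = 0 ∨ u = M then 1 / 2 else 1

/-- The weights `χ_u = ε_u ω_u` of the generalized Clenshaw-Curtis quadrature with nodes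
`cos (u π / M)` for `∫_0^π f(cos ϑ) sin^α ϑ dϑ`. Summands in which `α/2 - μ + 1` is a pole of
`Γ` are zero (`Real.Gamma` vanishes there, and so does the quotient). -/
def quadWeight (α M u : ℕ) : ℝ :=
  quadEps M u * (Real.pi * (α.factorial : ℝ) / (2 ^ (α - 1) * (M : ℝ)) *
    ∑ μ ∈ Finset.range (M / 2 + 1),
      quadEps M (2 * μ) * (-1) ^ μ * Real.cos (2 * (μ : ℝ) * (u : ℝ) * Real.pi / (M : ℝ)) /
        (Real.Gamma ((α : ℝ) / 2 - (μ : ℝ) + 1) * Real.Gamma ((α : ℝ) / 2 + (μ : ℝ) + 1)))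

/-- The weight `∏_{ν=1}^{n-1} χ_{s_ν}^{(j)}` of a node, where `χ_{s_ν}^{(j)}` is computed for
`M = 2^j` and `α = n - ν` (here `ν = i + 1`). -/
def nodeWeight (n j : ℕ) (p : NodeIndex n j) : ℝ :=
  ∏ i : Fin (n - 1), quadWeight (n - 1 - (i : ℕ)) (2 ^ j) (p.1 i : ℕ)

/-! ### Weighted scaling functions and frames -/

/-- The function `φ_j = 2^{-nj/2} ∑_{l < 2^(j-1)} ((l + λ)/λ) C_l^λ` on `[-1, 1]`. -/
def scalingKernel (n j : ℕ) (t : ℝ) : ℝ :=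
  (Real.sqrt 2 ^ (n * j))⁻¹ *
    ∑ l ∈ Finset.range (2 ^ (j - 1)), ((l : ℝ) + lam n) / lam n * gegenbauer (lam n) l t

/-- The weighted scaling function `φ_j(∘ · y)` on `S^n`. -/
def scalingFun (n j : ℕ) (y : Sph n) : Sph n → ℂ :=
  fun x => (scalingKernel n j (inner ℝ x.1 y.1) : ℂ)

/-- A finite family `g` is a tight frame with frame constant `A` in the subspace `V`. -/
def IsTightFrame {ι : Type*} [Fintype ι] (n : ℕ) (V : Submodule ℂ (Sph n → ℂ))
    (g : ι → Sph n → ℂ) (A : ℝ) : Prop :=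
  0 < A ∧ (∀ i, g i ∈ V) ∧ ∀ f ∈ V, ∑ i, ‖sInner n f (g i)‖ ^ 2 = A * sNorm n f ^ 2

end SphereWavelet

end

open SphereWavelet

/-!
The scaling function `φ_j(∘ · y)` is, up to the factor `2^(-nj/2)`, the reproducing kernel of the
space `V_j` of spherical harmonics of degree less than `2^(j-1)`. The expansion in orthonormal bases,
the norm, the extremal property, the Fourier coefficients and the integral are formal consequences
of that. The reconstruction from samples and the tight frame need in addition that the nodes and
weights integrate products of two functions of `V_j` exactly.

*The reproducing property.* For polynomials `p`, homogeneous of degree `k`, polar coordinates turn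
the integral of `p` over the sphere into a multiple of the Gaussian functional
`L(p) = ∫ p(x) e^{-|x|²} dx` (`integral_restrictSphere_of_isHomogeneous`), for which integration by
parts is the purely algebraic rule `L(x_i p) = L(∂_i p) / 2` (`gaussFunctional_X_mul`). With Euler's
identity it gives Green's formula, whence the orthogonality of harmonics of different degrees
(`gaussFunctional_mul_eq_zero`). By induction on `m` it also gives the pairing of `(x · y)^m` with a
harmonic polynomial `f` of degree `l`: zero if `m < l`, a multiple of `f(y)` if `m = l`
(`gaussFunctional_linForm_pow_mul`). So only the leading term of `C_l^λ(x · y)` contributes to its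
pairing with `f` (`integral_gegenbauer_mul`).

*Harmonicity.* Both the zonal functions `C_l^λ(x · y)` and the basis functions `Y_l^k` are products
of homogenized Gegenbauer polynomials `R^(m/2) C_m^μ(u / √R)`. One computation of a Laplacian,
in which the terms telescope, covers the two cases (`laplacian_mul_homGegenbauer`). For `Y_l^k` the
factors are multiplied together starting from the last two coordinates
(`exists_harmonic_of_tail`).

*Quadrature.* In spherical coordinates a monomial separates into one-dimensional factors
`cos^a ϑ sin^b ϑ` (`prod_sphCoord_pow`). If `b` is even, such a factor is a combination of the
cosines `cos (k ϑ)`, `k ≤ a + b`, on which the generalized Clenshaw-Curtis rule is exact by discrete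
orthogonality and the formula for `∫ cos (2μϑ) sin^α ϑ dϑ` (`sum_quadWeight_mul_cos`). The resulting
beta integrals telescope to the moment of the sphere. If some exponent is odd, the last odd one
makes both sides vanish (`sum_nodes_monomial`).

The value of the kernel on the diagonal follows from the three-term recurrence
(`gegenbauer_recurrence`), and for `n ≤ 3` only the exponents `α = 1, 2` occur in the weights, for
which the sums are estimated directly (`quadWeight_one_nonneg`, `quadWeight_two_nonneg`).
-/

namespace SphereWavelet

section

/-! ### Moments of the sphere and of the Gaussian weight -/

open Real Set in
theorem integral_Ioi_pow_mul_exp_neg_sq (k : ℕ) :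
    ∫ x in Ioi (0 : ℝ), x ^ k * exp (-x ^ 2) = Real.Gamma (((k : ℝ) + 1) / 2) / 2 := by
  have h := integral_rpow_mul_exp_neg_rpow (p := 2) (q := (k : ℝ)) (by norm_num)
    (by have : (0 : ℝ) ≤ k := Nat.cast_nonneg k
        linarith)
  have h2 : ∀ x : ℝ, x ^ (k : ℝ) * exp (-x ^ (2 : ℝ)) = x ^ k * exp (-x ^ 2) := by
    intro x
    rw [Real.rpow_natCast, ← Real.rpow_natCast x 2]
    norm_num
  simp only [h2] at h
  rw [h]
  ring

/-- The moments `∫ x^k e^{-x²} dx` of the Gaussian weight on the line; the odd ones vanish. -/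
noncomputable def gaussMoment (k : ℕ) : ℝ := if Even k then Real.Gamma (((k : ℝ) + 1) / 2) else 0

theorem gaussMoment_one : gaussMoment 1 = 0 := by simp [gaussMoment]

theorem gaussMoment_add_two (k : ℕ) :
    gaussMoment (k + 2) = ((k : ℝ) + 1) / 2 * gaussMoment k := by
  unfold gaussMoment
  by_cases h : Even k
  · rw [if_pos h, if_pos (by simpa [Nat.even_add] using h), ← Real.Gamma_add_one (by positivity)]
    push_cast
    congr 1
    ring
  · rw [if_neg h, if_neg (by simpa [Nat.even_add] using h), mul_zero]

open Real Set in
theorem integral_pow_mul_exp_neg_sq (k : ℕ) :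
    ∫ x : ℝ, x ^ k * exp (-x ^ 2) = gaussMoment k := by
  unfold gaussMoment
  split_ifs with h
  · have h1 := integral_comp_abs (f := fun x : ℝ => x ^ k * exp (-x ^ 2))
    simp only [h.pow_abs, sq_abs] at h1
    rw [h1, integral_Ioi_pow_mul_exp_neg_sq]
    ring
  · have h1 := integral_neg_eq_self (fun x : ℝ => x ^ k * exp (-x ^ 2)) volume
    rw [Nat.not_even_iff_odd] at h
    simp only [h.neg_pow, neg_sq, neg_mul, integral_neg] at h1
    linarith

/-- The moments of the Gaussian weight `e^{-|x|²}` on Euclidean space are products. -/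
theorem integral_prod_pow_mul_exp_neg_sq {d : ℕ} (a : Fin d → ℕ) :
    ∫ x : EuclideanSpace ℝ (Fin d), (∏ i, x i ^ a i) * Real.exp (-‖x‖ ^ 2) =
      ∏ i, gaussMoment (a i) := by
  simp_rw [← integral_pow_mul_exp_neg_sq]
  rw [← integral_fintype_prod_volume_eq_prod (fun i (x : ℝ) => x ^ a i * Real.exp (-x ^ 2)),
    ← (EuclideanSpace.volume_preserving_symm_measurableEquiv_toLp (Fin d)).integral_comp
      (MeasurableEquiv.measurableEmbedding _)]
  refine integral_congr_ae (Filter.Eventually.of_forall fun x => ?_)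
  simp only [Finset.prod_mul_distrib, ← Real.exp_sum, Finset.sum_neg_distrib]
  congr 3
  rw [EuclideanSpace.norm_sq_eq]
  simp

open Measure Set in
/-- Polar coordinates: the integral of a function which is homogeneous of degree `k`, against the
Gaussian weight, is a multiple of its integral over the sphere. -/
theorem integral_homogeneous_mul_exp_neg_sq (n k : ℕ) (f : EuclideanSpace ℝ (Fin (n + 1)) → ℝ)
    (hf : ∀ (r : ℝ) x, 0 < r → f (r • x) = r ^ k * f x) :
    ∫ x, f x * Real.exp (-‖x‖ ^ 2) =
      (∫ x : Sph n, f x.1 ∂(sigma n)) * (Real.Gamma (((k + n : ℕ) + 1) / 2) / 2) := by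
  have hd : Module.finrank ℝ (EuclideanSpace ℝ (Fin (n + 1))) - 1 = n := by simp
  calc
    ∫ x, f x * Real.exp (-‖x‖ ^ 2)
      = ∫ x : ({0}ᶜ : Set (EuclideanSpace ℝ (Fin (n + 1)))), f x.1 * Real.exp (-‖x.1‖ ^ 2)
          ∂(volume.comap Subtype.val) := by
      rw [integral_subtype_comap (measurableSet_singleton _).compl
        fun x : EuclideanSpace ℝ (Fin (n + 1)) ↦ f x * Real.exp (-‖x‖ ^ 2), restrict_compl_singleton]
    _ = ∫ x : Sph n × Ioi (0 : ℝ), f x.1.1 * (x.2.1 ^ k * Real.exp (-x.2.1 ^ 2))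
          ∂(volume : Measure (EuclideanSpace ℝ (Fin (n + 1)))).toSphere.prod (.volumeIoiPow n) := by
      have := (volume : Measure (EuclideanSpace ℝ (Fin (n + 1)))).measurePreserving_homeomorphUnitSphereProd.integral_comp
        (Homeomorph.measurableEmbedding _)
        (fun x : Sph n × Ioi (0 : ℝ) => f x.1.1 * (x.2.1 ^ k * Real.exp (-x.2.1 ^ 2)))
      rw [hd] at this
      rw [← this]
      refine integral_congr_ae (Filter.Eventually.of_forall fun x => ?_)
      have hx : 0 < ‖x.1‖ := norm_pos_iff.2 x.2
      simp only [homeomorphUnitSphereProd_apply_fst_coe, homeomorphUnitSphereProd_apply_snd_coe]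
      rw [hf _ _ (inv_pos.2 hx), inv_pow]
      field_simp
    _ = (∫ x : Sph n, f x.1 ∂(sigma n)) *
          ∫ x : Ioi (0 : ℝ), x.1 ^ k * Real.exp (-x.1 ^ 2) ∂(.volumeIoiPow n) := by
      rw [sigma, ← integral_prod_mul]
    _ = _ := by
      congr 1
      rw [← integral_Ioi_pow_mul_exp_neg_sq]
      simp only [Measure.volumeIoiPow, ENNReal.ofReal]
      rw [integral_withDensity_eq_integral_smul (measurable_subtype_coe.pow_const _).real_toNNReal,
        integral_subtype_comap measurableSet_Ioi
          fun a : ℝ ↦ Real.toNNReal (a ^ n) • (a ^ k * Real.exp (-a ^ 2)),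
        setIntegral_congr_fun measurableSet_Ioi fun x hx ↦ ?_]
      rw [NNReal.smul_def, Real.coe_toNNReal _ (pow_nonneg (le_of_lt hx) _), smul_eq_mul, pow_add]
      ring

theorem integral_sphere_monomial (n : ℕ) (a : Fin (n + 1) → ℕ) :
    ∫ x : Sph n, ∏ i, x.1 i ^ a i ∂(sigma n) =
      2 / Real.Gamma (((∑ i, a i + n : ℕ) + 1) / 2) * ∏ i, gaussMoment (a i) := by
  have h := integral_homogeneous_mul_exp_neg_sq n (∑ i, a i) (fun x => ∏ i, x i ^ a i) (by
    intro r x _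
    simp [mul_pow, Finset.prod_mul_distrib, Finset.prod_pow_eq_pow_sum])
  rw [integral_prod_pow_mul_exp_neg_sq] at h
  have := Real.Gamma_pos_of_pos (s := (((∑ i, a i + n : ℕ) : ℝ) + 1) / 2) (by positivity)
  rw [h]
  field_simp

open MvPolynomial

theorem restrictSphere_apply (n : ℕ) (p : MvPolynomial (Fin (n + 1)) ℂ) (x : Sph n) :
    restrictSphere n p x = eval (fun i : Fin (n + 1) => ((x.1 i : ℝ) : ℂ)) p := rfl

theorem continuous_restrictSphere (n : ℕ) (p : MvPolynomial (Fin (n + 1)) ℂ) :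
    Continuous (restrictSphere n p) := by
  simp only [funext (restrictSphere_apply n p)]
  exact (MvPolynomial.continuous_eval p).comp (by fun_prop)

theorem integrable_of_continuous {n : ℕ} {f : Sph n → ℂ} (hf : Continuous f) :
    Integrable f (sigma n) := by
  unfold sigma
  exact hf.integrable_of_hasCompactSupport (HasCompactSupport.of_compactSpace f)

theorem integrable_restrictSphere (n : ℕ) (p : MvPolynomial (Fin (n + 1)) ℂ) :
    Integrable (restrictSphere n p) (sigma n) :=
  integrable_of_continuous (continuous_restrictSphere n p)

theorem integral_restrictSphere_monomial (n : ℕ) (a : Fin (n + 1) →₀ ℕ) (c : ℂ) :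
    ∫ x, restrictSphere n (monomial a c) x ∂(sigma n) =
      c * ((2 / Real.Gamma (((∑ i, a i + n : ℕ) + 1) / 2) * ∏ i, gaussMoment (a i) : ℝ) : ℂ) := by
  have h : ∀ x : Sph n, restrictSphere n (monomial a c) x =
      c * ((∏ i, x.1 i ^ a i : ℝ) : ℂ) := by
    intro x
    rw [restrictSphere_apply, eval_monomial, Finsupp.prod_fintype _ _ (by simp)]
    simp
  simp_rw [h]
  rw [integral_const_mul, integral_complex_ofReal, integral_sphere_monomial]

/-- The Gaussian functional `L(p) = ∫ p(x) e^{-|x|²} dx`, defined on monomials by the product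
formula. -/
noncomputable def gaussFunctional (d : ℕ) : MvPolynomial (Fin d) ℂ →ₗ[ℂ] ℂ :=
  (basisMonomials (Fin d) ℂ).constr ℂ fun a => ((∏ i, gaussMoment (a i) : ℝ) : ℂ)

theorem gaussFunctional_monomial {d : ℕ} (a : Fin d →₀ ℕ) (c : ℂ) :
    gaussFunctional d (monomial a c) = c * ((∏ i, gaussMoment (a i) : ℝ) : ℂ) := by
  have h := (basisMonomials (Fin d) ℂ).constr_basis ℂ
    (fun a => ((∏ i, gaussMoment (a i) : ℝ) : ℂ)) a
  rw [coe_basisMonomials] at h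
  rw [show (monomial a c : MvPolynomial (Fin d) ℂ) = c • monomial a 1 by simp [smul_monomial],
    map_smul, gaussFunctional, h, smul_eq_mul]

theorem integral_restrictSphere_of_isHomogeneous {n k : ℕ} {p : MvPolynomial (Fin (n + 1)) ℂ}
    (hp : p.IsHomogeneous k) :
    ∫ x, restrictSphere n p x ∂(sigma n) =
      ((2 / Real.Gamma (((k + n : ℕ) + 1) / 2) : ℝ) : ℂ) * gaussFunctional (n + 1) p := by
  have h1 : ∀ x, restrictSphere n p x =
      ∑ a ∈ p.support, restrictSphere n (monomial a (coeff a p)) x := by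
    intro x
    conv_lhs => rw [p.as_sum, map_sum]
    exact Finset.sum_apply _ _ _
  have h2 : gaussFunctional (n + 1) p =
      ∑ a ∈ p.support, gaussFunctional (n + 1) (monomial a (coeff a p)) := by
    conv_lhs => rw [p.as_sum, map_sum]
  simp_rw [h1]
  rw [integral_finsetSum _ fun a _ => integrable_restrictSphere n _, h2, Finset.mul_sum]
  refine Finset.sum_congr rfl fun a ha => ?_
  have hk : ∑ i, a i = k := by
    have := hp (mem_support_iff.1 ha)
    rwa [← Finsupp.degree_eq_sum, Finsupp.degree_eq_weight_one (R := ℕ)]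
  rw [integral_restrictSphere_monomial, gaussFunctional_monomial, hk]
  push_cast
  ring

/-- Gaussian integration by parts. -/
theorem gaussFunctional_X_mul {d : ℕ} (i : Fin d) (p : MvPolynomial (Fin d) ℂ) :
    gaussFunctional d (X i * p) = 1 / 2 * gaussFunctional d (pderiv i p) := by
  induction p using MvPolynomial.induction_on' with
  | add p q hp hq => simp only [mul_add, map_add, hp, hq]
  | monomial a c =>
    rw [X, monomial_mul, pderiv_monomial, gaussFunctional_monomial, gaussFunctional_monomial,
      ← Finset.mul_prod_erase _ _ (Finset.mem_univ i),
      ← Finset.mul_prod_erase (Finset.univ) (fun j => gaussMoment _) (Finset.mem_univ i)]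
    have h1 : ∏ j ∈ Finset.univ.erase i, gaussMoment ((Finsupp.single i 1 + a : Fin d →₀ ℕ) j) =
        ∏ j ∈ Finset.univ.erase i, gaussMoment (a j) :=
      Finset.prod_congr rfl fun j hj => by
        simp [(Finset.ne_of_mem_erase hj).symm]
    have h2 : ∏ j ∈ Finset.univ.erase i, gaussMoment ((a - Finsupp.single i 1 : Fin d →₀ ℕ) j) =
        ∏ j ∈ Finset.univ.erase i, gaussMoment (a j) :=
      Finset.prod_congr rfl fun j hj => by
        simp [(Finset.ne_of_mem_erase hj).symm]
    rw [h1, h2]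
    have h3 : gaussMoment ((Finsupp.single i 1 + a : Fin d →₀ ℕ) i) =
        (a i : ℝ) / 2 * gaussMoment ((a - Finsupp.single i 1 : Fin d →₀ ℕ) i) := by
      simp only [Finsupp.add_apply, Finsupp.single_eq_same, Finsupp.tsub_apply]
      rcases h : a i with _ | m
      · simp [gaussMoment_one]
      · rw [show 1 + (m + 1) = m + 2 by ring, gaussMoment_add_two]
        simp
    rw [h3]
    push_cast
    ring

end

section

/-! ### The Laplacian and the Gaussian functional -/

open MvPolynomial

variable {n : ℕ}

theorem laplacian_apply (p : MvPolynomial (Fin (n + 1)) ℂ) :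
    laplacian n p = ∑ i, pderiv i (pderiv i p) := by
  simp [laplacian, LinearMap.sum_apply]

/-- The derivation `∇f · ∇` of the polynomial ring. -/
noncomputable def gradDeriv (f : MvPolynomial (Fin (n + 1)) ℂ) :
    Derivation ℂ (MvPolynomial (Fin (n + 1)) ℂ) (MvPolynomial (Fin (n + 1)) ℂ) :=
  ∑ i, pderiv i f • pderiv i

theorem gradDeriv_apply (f g : MvPolynomial (Fin (n + 1)) ℂ) :
    gradDeriv f g = ∑ i, pderiv i f * pderiv i g := by
  have h : ∀ s : Finset (Fin (n + 1)), (∑ i ∈ s, pderiv i f • pderiv i : Derivation ℂ _ _) g =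
      ∑ i ∈ s, pderiv i f * pderiv i g := by
    intro s
    induction s using Finset.induction_on with
    | empty => simp
    | insert i s hi ih => rw [Finset.sum_insert hi, Finset.sum_insert hi, Derivation.add_apply, ih]; rfl
  exact h _

theorem gradDeriv_comm (f g : MvPolynomial (Fin (n + 1)) ℂ) : gradDeriv f g = gradDeriv g f := by
  simp only [gradDeriv_apply, mul_comm]

theorem laplacian_mul (f g : MvPolynomial (Fin (n + 1)) ℂ) :
    laplacian n (f * g) = f * laplacian n g + g * laplacian n f + 2 * gradDeriv f g := by
  simp only [laplacian_apply, gradDeriv_apply, Finset.mul_sum, ← Finset.sum_add_distrib]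
  refine Finset.sum_congr rfl fun i _ => ?_
  simp only [pderiv_mul, map_add]
  ring

theorem laplacian_pow (f : MvPolynomial (Fin (n + 1)) ℂ) (k : ℕ) :
    laplacian n (f ^ k) = (k : MvPolynomial (Fin (n + 1)) ℂ) * f ^ (k - 1) * laplacian n f +
      (k : MvPolynomial (Fin (n + 1)) ℂ) * ((k : MvPolynomial (Fin (n + 1)) ℂ) - 1) *
        f ^ (k - 2) * gradDeriv f f := by
  induction k with
  | zero => simp [laplacian_apply]
  | succ k ih =>
    rw [pow_succ, laplacian_mul, ih, gradDeriv_comm (f ^ k) f, Derivation.leibniz_pow]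
    rcases k with _ | _ | k
    · simp
    · simp
      ring
    · simp only [nsmul_eq_mul, smul_eq_mul]
      push_cast
      ring

/-- Green's formula for the Gaussian functional. -/
theorem gaussFunctional_mul_of_harmonic {l : ℕ} {f g : MvPolynomial (Fin (n + 1)) ℂ}
    (hf : f.IsHomogeneous l) (hΔ : laplacian n f = 0) :
    (l : ℂ) * gaussFunctional (n + 1) (f * g) =
      1 / 2 * gaussFunctional (n + 1) (gradDeriv f g) := by
  -- Euler's identity, times `g`
  have h1 : (l : ℂ) • (f * g) = ∑ i, X i * (pderiv i f * g) := by
    have := hf.sum_X_mul_pderiv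
    rw [Finset.sum_congr rfl fun i _ => (mul_assoc (X i) (pderiv i f) g).symm, ← Finset.sum_mul,
      this, smul_mul_assoc, Nat.cast_smul_eq_nsmul]
  rw [← smul_eq_mul (l : ℂ), ← map_smul, h1, map_sum]
  simp_rw [gaussFunctional_X_mul, pderiv_mul]
  rw [← Finset.mul_sum, ← map_sum, Finset.sum_add_distrib, ← Finset.sum_mul, ← laplacian_apply, hΔ,
    zero_mul, zero_add, gradDeriv_apply]

theorem gaussFunctional_mul_eq_zero {l l' : ℕ} {f g : MvPolynomial (Fin (n + 1)) ℂ}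
    (hf : f.IsHomogeneous l) (hΔf : laplacian n f = 0) (hg : g.IsHomogeneous l')
    (hΔg : laplacian n g = 0) (h : l ≠ l') : gaussFunctional (n + 1) (f * g) = 0 := by
  have h1 := gaussFunctional_mul_of_harmonic (g := g) hf hΔf
  have h2 := gaussFunctional_mul_of_harmonic (g := f) hg hΔg
  rw [gradDeriv_comm, ← h1, mul_comm g f] at h2
  have h3 : ((l' : ℂ) - l) ≠ 0 := sub_ne_zero.2 (by exact_mod_cast h.symm)
  refine (mul_eq_zero.1 (?_ : ((l' : ℂ) - l) * _ = 0)).resolve_left h3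
  rw [sub_mul, h2, sub_self]

/-- The linear form `x ↦ x · y`. -/
noncomputable def linForm (y : Fin (n + 1) → ℂ) : MvPolynomial (Fin (n + 1)) ℂ :=
  ∑ i, C (y i) * X i

theorem pderiv_linForm (y : Fin (n + 1) → ℂ) (i : Fin (n + 1)) :
    pderiv i (linForm y) = C (y i) := by
  simp [linForm, Pi.single_apply]

theorem isHomogeneous_linForm (y : Fin (n + 1) → ℂ) : (linForm y).IsHomogeneous 1 :=
  IsHomogeneous.sum _ _ _ fun i _ => by
    simpa using (isHomogeneous_C _ (y i)).mul (isHomogeneous_X ℂ i)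

theorem gradDeriv_linForm (y : Fin (n + 1) → ℂ) (f : MvPolynomial (Fin (n + 1)) ℂ) :
    gradDeriv (linForm y) f = ∑ i, C (y i) * pderiv i f := by
  simp [gradDeriv_apply, pderiv_linForm]

theorem pderiv_comm (i j : Fin (n + 1)) (f : MvPolynomial (Fin (n + 1)) ℂ) :
    pderiv i (pderiv j f) = pderiv j (pderiv i f) := by
  have h : ⁅pderiv (R := ℂ) i, pderiv j⁆ = 0 := derivation_ext fun k => by
    rw [Derivation.commutator_apply, pderiv_X, pderiv_X]
    simp only [Pi.single_apply]
    split_ifs <;> simp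
  rw [← sub_eq_zero, ← Derivation.commutator_apply, h]
  rfl

theorem laplacian_gradDeriv_linForm (y : Fin (n + 1) → ℂ) (f : MvPolynomial (Fin (n + 1)) ℂ) :
    laplacian n (gradDeriv (linForm y) f) = gradDeriv (linForm y) (laplacian n f) := by
  simp only [laplacian_apply, gradDeriv_linForm, map_sum, pderiv_mul, pderiv_C,
    zero_mul, zero_add]
  rw [Finset.sum_comm]
  refine Finset.sum_congr rfl fun i _ => Finset.sum_congr rfl fun j _ => ?_
  rw [pderiv_comm j i (pderiv i f), pderiv_comm j i f]

theorem gaussFunctional_linForm_mul (y : Fin (n + 1) → ℂ) (p : MvPolynomial (Fin (n + 1)) ℂ) :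
    gaussFunctional (n + 1) (linForm y * p) =
      1 / 2 * gaussFunctional (n + 1) (gradDeriv (linForm y) p) := by
  rw [linForm, Finset.sum_mul, map_sum, ← linForm, gradDeriv_linForm, map_sum, Finset.mul_sum]
  refine Finset.sum_congr rfl fun i _ => ?_
  rw [mul_assoc, C_mul', C_mul', map_smul, map_smul, gaussFunctional_X_mul, smul_eq_mul,
    smul_eq_mul]
  ring

/-- The pairing of a harmonic polynomial of degree `l` with the powers `(x · y)^m`, `m ≤ l`. -/
theorem gaussFunctional_linForm_pow_mul (y : Fin (n + 1) → ℂ) (m : ℕ) :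
    ∀ (l : ℕ) (f : MvPolynomial (Fin (n + 1)) ℂ), m ≤ l → f.IsHomogeneous l →
      laplacian n f = 0 → gaussFunctional (n + 1) (linForm y ^ m * f) =
        if m = l then (l.factorial : ℂ) / 2 ^ l * eval y f * gaussFunctional (n + 1) 1 else 0 := by
  induction m using Nat.strong_induction_on with
  | _ m ih =>
    intro l f hml hf hΔ
    rcases m with _ | m
    · rcases Nat.eq_zero_or_pos l with rfl | hl
      · obtain ⟨c, rfl⟩ : ∃ c, f = C c := ⟨_, totalDegree_eq_zero_iff_eq_C.1
          (Nat.le_zero.1 hf.totalDegree_le)⟩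
        rw [pow_zero, one_mul, ← mul_one (C c), C_mul', map_smul]
        simp
      · rw [if_neg hl.ne, pow_zero, mul_comm]
        exact gaussFunctional_mul_eq_zero hf hΔ (isHomogeneous_one _ _)
          (by simp [laplacian_apply]) hl.ne'
    · obtain ⟨l, rfl⟩ : ∃ l', l = l' + 1 := ⟨l - 1, by omega⟩
      have hyy : gradDeriv (linForm y) (linForm y) = C (∑ i, y i * y i) := by
        simp [gradDeriv_linForm, pderiv_linForm]
      have hg : (gradDeriv (linForm y) f).IsHomogeneous l := by
        rw [gradDeriv_linForm]
        exact IsHomogeneous.sum _ _ _ fun i _ => by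
          simpa using (isHomogeneous_C _ (y i)).mul (hf.pderiv (i := i))
      have hgy : eval y (gradDeriv (linForm y) f) = (l + 1 : ℕ) * eval y f := by
        have := congrArg (eval y) hf.sum_X_mul_pderiv
        simpa [gradDeriv_linForm] using this
      have hΔg : laplacian n (gradDeriv (linForm y) f) = 0 := by
        rw [laplacian_gradDeriv_linForm, hΔ, map_zero]
      -- Integration by parts of one factor `x · y` differentiates either another such factor, which
      -- leaves too low a power, or `f`, which lowers both degrees by one.
      rw [pow_succ', mul_assoc, gaussFunctional_linForm_mul, Derivation.leibniz,
        Derivation.leibniz_pow, hyy]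
      have h2 : gaussFunctional (n + 1) (f • m • linForm y ^ (m - 1) • C (∑ i, y i * y i)) = 0 := by
        rcases Nat.eq_zero_or_pos m with rfl | hm
        · simp
        · rw [show f • m • linForm y ^ (m - 1) • C (∑ i, y i * y i) =
            ((m : ℂ) * ∑ i, y i * y i) • (linForm y ^ (m - 1) * f) by
              simp [MvPolynomial.smul_eq_C_mul]; ring, map_smul,
            ih (m - 1) (by omega) (l + 1) f (by omega) hf hΔ, if_neg (by omega), smul_zero]
      rw [map_add, h2, add_zero, smul_eq_mul, ih m (by omega) l _ (by omega) hg hΔg, hgy]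
      simp only [add_left_inj]
      split_ifs
      · rw [Nat.factorial_succ]
        push_cast
        ring
      · simp

end

section

/-! ### Homogenized Gegenbauer polynomials -/

open MvPolynomial

variable {n : ℕ}

/-- The coefficient of `(2t)^(l-2k)` in the Gegenbauer polynomial `C_l^μ(t)`. -/
noncomputable def gegenbauerCoeff (μ : ℝ) (l k : ℕ) : ℝ :=
  (-1) ^ k * (ascPochhammer ℝ (l - k)).eval μ / ((k.factorial : ℝ) * ((l - 2 * k).factorial : ℝ))

theorem gegenbauer_eq_sum (μ : ℝ) (l : ℕ) (t : ℝ) :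
    gegenbauer μ l t =
      ∑ k ∈ Finset.range (l / 2 + 1), gegenbauerCoeff μ l k * (2 * t) ^ (l - 2 * k) := rfl

theorem gegenbauerCoeff_succ (μ : ℝ) {m k : ℕ} (h : 2 * (k + 1) ≤ m) :
    ((m - 2 * k : ℕ) : ℝ) * ((m - 2 * k : ℕ) - 1) * gegenbauerCoeff μ m k =
      -((k + 1 : ℕ) * (μ + (k + 1 : ℕ) + (m - 2 * (k + 1) : ℕ)) *
        gegenbauerCoeff μ m (k + 1)) := by
  obtain ⟨a, rfl⟩ := Nat.exists_eq_add_of_le h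
  have h1 : 2 * (k + 1) + a - 2 * k = a + 1 + 1 := by omega
  have h2 : 2 * (k + 1) + a - k = (k + 1 + a) + 1 := by omega
  have h3 : 2 * (k + 1) + a - (k + 1) = k + 1 + a := by omega
  simp only [gegenbauerCoeff, h1, h2, h3, add_tsub_cancel_left, ascPochhammer_succ_eval,
    Nat.factorial_succ, pow_succ]
  push_cast
  have ha : (a.factorial : ℝ) ≠ 0 := by positivity
  have hk : (k.factorial : ℝ) ≠ 0 := by positivity
  field_simp
  ring

theorem laplacian_mul_pow_mul_pow {v R h : MvPolynomial (Fin (n + 1)) ℂ} {D q μ : ℂ}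
    (hμ : D + 2 * q = 2 * μ + 2) (hv : laplacian n v = 0) (hvv : gradDeriv v v = C 4)
    (hvR : gradDeriv v R = 2 * v) (hRR : gradDeriv R R = 4 * R) (hR : laplacian n R = C (2 * D))
    (hh : laplacian n h = 0) (hhv : gradDeriv h v = 0) (hhR : gradDeriv h R = C (2 * q) * h)
    (a k : ℕ) :
    laplacian n (h * (v ^ a * R ^ k)) = C (4 * (a * (a - 1)) : ℂ) * (h * (v ^ (a - 2) * R ^ k)) +
      C (4 * (k * (μ + k + a)) : ℂ) * (h * (v ^ a * R ^ (k - 1))) := by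
  have h1 : gradDeriv (v ^ a) (R ^ k) =
      C (2 * a * k : ℂ) * (v ^ a * R ^ (k - 1)) := by
    rw [Derivation.leibniz_pow, gradDeriv_comm, Derivation.leibniz_pow, gradDeriv_comm, hvR]
    rcases a with _ | a
    · simp
    · simp only [nsmul_eq_mul, smul_eq_mul, map_mul, map_natCast, map_ofNat, add_tsub_cancel_right]
      ring
  have h2 : gradDeriv h (v ^ a * R ^ k) = C (2 * q * k : ℂ) * (h * (v ^ a * R ^ (k - 1))) := by
    rw [Derivation.leibniz, Derivation.leibniz_pow, Derivation.leibniz_pow, hhv, hhR]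
    simp only [nsmul_eq_mul, smul_eq_mul, map_mul, map_natCast, map_ofNat, mul_zero, add_zero]
    ring
  have h3 : laplacian n (R ^ k) = C (2 * k * (D + 2 * (k - 1)) : ℂ) * R ^ (k - 1) := by
    rw [laplacian_pow, hRR, hR]
    rcases k with _ | _ | k
    · simp
    · simp
    · simp only [map_mul, map_natCast, map_ofNat, map_add, map_sub, map_one]
      push_cast
      ring
  have hD : D = 2 * μ + 2 - 2 * q := by rw [← hμ]; ring
  rw [laplacian_mul, laplacian_mul, hh, h1, h2, h3, laplacian_pow, hv, hvv, hD]
  simp only [map_mul, map_natCast, map_ofNat, map_add, map_sub, map_one]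
  ring

/-- The homogeneous form `R^(m/2) C_m^μ(u / √R)` of a Gegenbauer polynomial. -/
noncomputable def homGegenbauer (μ : ℝ) (m : ℕ) (u R : MvPolynomial (Fin (n + 1)) ℂ) :
    MvPolynomial (Fin (n + 1)) ℂ :=
  ∑ k ∈ Finset.range (m / 2 + 1), C (gegenbauerCoeff μ m k : ℂ) * ((2 * u) ^ (m - 2 * k) * R ^ k)

/-- Multiplying a harmonic polynomial `h` by a homogenized Gegenbauer polynomial of the right index
gives a harmonic polynomial. The applications are `u = x · y`, `R = |x|²`, `h = 1` (zonal
harmonics) and `u = x_i`, `R = ∑_{m ≥ i} x_m²`, with `h` homogeneous of degree `q` in the variables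
after `x_i` (separation of variables). -/
theorem laplacian_mul_homGegenbauer {u R h : MvPolynomial (Fin (n + 1)) ℂ} {D q : ℂ} {μ : ℝ}
    (hμ : D + 2 * q = 2 * μ + 2) (hu : laplacian n u = 0) (huu : gradDeriv u u = 1)
    (huR : gradDeriv u R = 2 * u) (hRR : gradDeriv R R = 4 * R) (hR : laplacian n R = C (2 * D))
    (hh : laplacian n h = 0) (hhu : gradDeriv h u = 0) (hhR : gradDeriv h R = C (2 * q) * h)
    (m : ℕ) : laplacian n (h * homGegenbauer μ m u R) = 0 := by
  have h2u : (2 * u : MvPolynomial (Fin (n + 1)) ℂ) = (2 : ℂ) • u := by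
    rw [MvPolynomial.smul_eq_C_mul, map_ofNat]
  have key := laplacian_mul_pow_mul_pow (v := 2 * u) (R := R) (h := h) hμ
    (by rw [h2u, map_smul, hu, smul_zero])
    (by rw [h2u, Derivation.map_smul, gradDeriv_comm, Derivation.map_smul, huu, smul_smul,
          MvPolynomial.smul_eq_C_mul, mul_one]; norm_num)
    (by rw [gradDeriv_comm, h2u, Derivation.map_smul, gradDeriv_comm, huR, ← h2u,
          MvPolynomial.smul_eq_C_mul, map_ofNat])
    hRR hR hh (by rw [h2u, Derivation.map_smul, hhu, smul_zero]) hhR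
  have hterm : ∀ k, laplacian n (h * (C (gegenbauerCoeff μ m k : ℂ) *
      ((2 * u) ^ (m - 2 * k) * R ^ k))) =
      C (4 * ((m - 2 * k : ℕ) * ((m - 2 * k : ℕ) - 1) * gegenbauerCoeff μ m k : ℂ)) *
        (h * ((2 * u) ^ (m - 2 * k - 2) * R ^ k)) +
      C (4 * (k * (μ + k + (m - 2 * k : ℕ)) * gegenbauerCoeff μ m k : ℂ)) *
        (h * ((2 * u) ^ (m - 2 * k) * R ^ (k - 1))) := by
    intro k
    rw [mul_left_comm, C_mul', map_smul, key, MvPolynomial.smul_eq_C_mul]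
    simp only [map_mul, map_natCast, map_ofNat, map_add, map_sub, map_one]
    ring
  rw [homGegenbauer, Finset.mul_sum, map_sum, Finset.sum_congr rfl fun k _ => hterm k,
    Finset.sum_add_distrib, Finset.sum_range_succ, Finset.sum_range_succ' (n := m / 2)]
  -- The first part of each term cancels the second part of the next one.
  have hlast : ((m - 2 * (m / 2) : ℕ) : ℂ) * ((m - 2 * (m / 2) : ℕ) - 1) = 0 := by
    rcases Nat.mod_two_eq_zero_or_one m with h | h
    · rw [show m - 2 * (m / 2) = 0 by omega]; simp
    · rw [show m - 2 * (m / 2) = 1 by omega]; simp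
  have hsum : ∑ k ∈ Finset.range (m / 2),
        C (4 * ((m - 2 * k : ℕ) * ((m - 2 * k : ℕ) - 1) * gegenbauerCoeff μ m k : ℂ)) *
          (h * ((2 * u) ^ (m - 2 * k - 2) * R ^ k)) =
      -∑ k ∈ Finset.range (m / 2),
        C (4 * ((k + 1 : ℕ) * (μ + (k + 1 : ℕ) + (m - 2 * (k + 1) : ℕ)) *
          gegenbauerCoeff μ m (k + 1) : ℂ)) *
          (h * ((2 * u) ^ (m - 2 * (k + 1)) * R ^ (k + 1 - 1))) := by
    rw [← Finset.sum_neg_distrib]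
    refine Finset.sum_congr rfl fun k hk => ?_
    have hk' : 2 * (k + 1) ≤ m := by have := Finset.mem_range.1 hk; omega
    have h1 := congrArg (fun x : ℝ => (x : ℂ)) (gegenbauerCoeff_succ μ hk')
    push_cast at h1
    push_cast
    rw [h1, show m - 2 * k - 2 = m - 2 * (k + 1) by omega]
    simp only [mul_neg, map_neg, neg_mul]
  rw [hsum, hlast]
  simp

theorem isHomogeneous_homGegenbauer (μ : ℝ) (m : ℕ) {u R : MvPolynomial (Fin (n + 1)) ℂ}
    (hu : u.IsHomogeneous 1) (hR : R.IsHomogeneous 2) : (homGegenbauer μ m u R).IsHomogeneous m := by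
  refine IsHomogeneous.sum _ _ _ fun k hk => ?_
  have h2 : ((2 * u : MvPolynomial (Fin (n + 1)) ℂ)).IsHomogeneous 1 := by
    have := (isHomogeneous_C (Fin (n + 1)) (2 : ℂ)).mul hu
    rwa [map_ofNat, zero_add] at this
  have h := (isHomogeneous_C (Fin (n + 1)) (gegenbauerCoeff μ m k : ℂ)).mul
    ((h2.pow (m - 2 * k)).mul (hR.pow k))
  have hk' := Finset.mem_range.1 hk
  rwa [show 0 + (1 * (m - 2 * k) + 2 * k) = m by omega] at h

/-- The value of a homogenized Gegenbauer polynomial where `u = ρ t` and `R = ρ²`. -/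
theorem eval_homGegenbauer (μ : ℝ) (m : ℕ) (u R : MvPolynomial (Fin (n + 1)) ℂ)
    (x : Fin (n + 1) → ℂ) (ρ t : ℝ) (hu : eval x u = (ρ * t : ℝ)) (hR : eval x R = (ρ ^ 2 : ℝ)) :
    eval x (homGegenbauer μ m u R) = (ρ ^ m * gegenbauer μ m t : ℝ) := by
  rw [homGegenbauer, gegenbauer_eq_sum, map_sum, Finset.mul_sum, Complex.ofReal_sum]
  refine Finset.sum_congr rfl fun k hk => ?_
  have hk' : m = (m - 2 * k) + 2 * k := by have := Finset.mem_range.1 hk; omega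
  simp only [map_mul, map_pow, eval_C, map_ofNat, hu, hR]
  conv_rhs => rw [show ρ ^ m = ρ ^ (m - 2 * k) * ρ ^ (2 * k) by rw [← pow_add, ← hk']]
  push_cast
  ring

/-- The squared norm `|x|²`, as a polynomial. -/
noncomputable def normSq (n : ℕ) : MvPolynomial (Fin (n + 1)) ℂ := ∑ i, X i ^ 2

/-- The zonal harmonic `|x|^l C_l^λ(x · y / |x|)`. -/
noncomputable def zonal (n l : ℕ) (y : Sph n) : MvPolynomial (Fin (n + 1)) ℂ :=
  homGegenbauer (lam n) l (linForm fun i => ((y.1 i : ℝ) : ℂ)) (normSq n)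

theorem sum_sq_eq_one (y : Sph n) : ∑ i, y.1 i ^ 2 = 1 := by
  have h : ‖y.1‖ = 1 := by simp
  rw [EuclideanSpace.norm_eq, Real.sqrt_eq_one] at h
  simpa using h

theorem eval_normSq (x : Sph n) : eval (fun i => ((x.1 i : ℝ) : ℂ)) (normSq n) = 1 := by
  have := congrArg (fun x : ℝ => (x : ℂ)) (sum_sq_eq_one x)
  simpa [normSq] using this

theorem eval_linForm (x y : Sph n) :
    eval (fun i => ((x.1 i : ℝ) : ℂ)) (linForm fun i => ((y.1 i : ℝ) : ℂ)) =
      (inner ℝ x.1 y.1 : ℝ) := by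
  simp [linForm, PiLp.inner_apply]

theorem restrictSphere_zonal (l : ℕ) (x y : Sph n) :
    restrictSphere n (zonal n l y) x = (gegenbauer (lam n) l (inner ℝ x.1 y.1) : ℝ) := by
  rw [restrictSphere_apply, zonal, eval_homGegenbauer _ _ _ _ _ 1 (inner ℝ x.1 y.1)]
  · simp
  · rw [eval_linForm, one_mul]
  · rw [eval_normSq]; simp

theorem isHomogeneous_normSq : (normSq n).IsHomogeneous 2 :=
  IsHomogeneous.sum _ _ _ fun i _ => by simpa using (isHomogeneous_X ℂ i).pow 2

theorem isHomogeneous_zonal (l : ℕ) (y : Sph n) : (zonal n l y).IsHomogeneous l :=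
  isHomogeneous_homGegenbauer _ _ (isHomogeneous_linForm _) isHomogeneous_normSq

theorem pderiv_normSq (i : Fin (n + 1)) : pderiv i (normSq n) = 2 * X i := by
  simp [normSq, Pi.single_apply]

theorem laplacian_zonal (l : ℕ) (y : Sph n) : laplacian n (zonal n l y) = 0 := by
  rw [zonal, ← one_mul (homGegenbauer _ _ _ _)]
  refine laplacian_mul_homGegenbauer (D := n + 1) (q := 0) ?_ ?_ ?_ ?_ ?_ ?_ ?_ ?_ ?_ l
  · unfold lam; push_cast; ring
  · simp [laplacian_apply, pderiv_linForm]
  · rw [gradDeriv_linForm]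
    simp only [pderiv_linForm, ← map_mul, ← map_sum]
    have := congrArg (fun x : ℝ => (x : ℂ)) (sum_sq_eq_one y)
    push_cast at this
    simp only [← sq, this, map_one]
  · rw [gradDeriv_linForm, linForm, Finset.mul_sum]
    simp only [pderiv_normSq]
    exact Finset.sum_congr rfl fun i _ => by ring
  · simp only [gradDeriv_apply, pderiv_normSq]
    rw [normSq, Finset.mul_sum]
    exact Finset.sum_congr rfl fun i _ => by ring
  · have h2 : (2 : MvPolynomial (Fin (n + 1)) ℂ) = C 2 := by rw [map_ofNat]
    simp only [laplacian_apply, pderiv_normSq, h2, pderiv_C_mul, pderiv_X_self]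
    simp
    ring
  · simp [laplacian_apply]
  · simp [gradDeriv_apply]
  · simp [gradDeriv_apply]

end

section

/-! ### Orthogonality and reproduction of spherical harmonics -/

open MvPolynomial

variable {n : ℕ}

theorem restrictSphere_mul (p q : MvPolynomial (Fin (n + 1)) ℂ) (x : Sph n) :
    restrictSphere n (p * q) x = restrictSphere n p x * restrictSphere n q x := by
  simp [restrictSphere_apply]

theorem restrictSphere_map_conj (p : MvPolynomial (Fin (n + 1)) ℂ) (x : Sph n) :
    restrictSphere n (map (starRingEnd ℂ) p) x = (starRingEnd ℂ) (restrictSphere n p x) := by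
  rw [restrictSphere_apply, restrictSphere_apply, eval_map, ← eval₂_id, eval₂_comp_left,
    RingHom.comp_id]
  congr 1
  funext i
  simp

theorem mem_harmonics {l : ℕ} {f : Sph n → ℂ} : f ∈ harmonics n l ↔
    ∃ p : MvPolynomial (Fin (n + 1)) ℂ, p.IsHomogeneous l ∧ laplacian n p = 0 ∧
      restrictSphere n p = f := by
  simp [harmonics, and_assoc]

theorem laplacian_map_conj (p : MvPolynomial (Fin (n + 1)) ℂ) :
    laplacian n (map (starRingEnd ℂ) p) = map (starRingEnd ℂ) (laplacian n p) := by
  simp [laplacian_apply, pderiv_map]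

theorem zonal_mem_harmonics (l : ℕ) (y : Sph n) :
    (fun x : Sph n => ((gegenbauer (lam n) l (inner ℝ x.1 y.1) : ℝ) : ℂ)) ∈ harmonics n l := by
  rw [mem_harmonics]
  refine ⟨zonal n l y, isHomogeneous_zonal l y, laplacian_zonal l y, ?_⟩
  funext x
  rw [restrictSphere_zonal]

theorem continuous_of_mem_harmonics {l : ℕ} {f : Sph n → ℂ} (hf : f ∈ harmonics n l) :
    Continuous f := by
  obtain ⟨p, -, -, rfl⟩ := mem_harmonics.1 hf
  exact continuous_restrictSphere n p

theorem sphereArea_pos (hn : 2 ≤ n) : 0 < sphereArea n := by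
  have h : 0 < lam n + 1 := by
    have : (2 : ℝ) ≤ n := by exact_mod_cast hn
    unfold lam; linarith
  have := Real.Gamma_pos_of_pos h
  have := Real.pi_pos
  unfold sphereArea
  positivity

theorem lam_pos (hn : 2 ≤ n) : 0 < lam n := by
  have : (2 : ℝ) ≤ n := by exact_mod_cast hn
  unfold lam; linarith

theorem sphereArea_eq_gaussFunctional_one :
    ((sphereArea n : ℝ) : ℂ) =
      ((2 / Real.Gamma (((n : ℕ) + 1) / 2) : ℝ) : ℂ) * gaussFunctional (n + 1) 1 := by
  have h := integral_restrictSphere_of_isHomogeneous (isHomogeneous_one (Fin (n + 1)) ℂ) (n := n)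
  have h1 : ∀ x, restrictSphere n 1 x = 1 := fun x => by simp [restrictSphere_apply]
  simp only [h1, integral_const, sigma_real_univ] at h
  simpa using h

/-- Harmonics of different degrees are orthogonal, in bilinear form. -/
theorem integral_mul_harmonics_eq_zero {l l' : ℕ} {f g : Sph n → ℂ} (hf : f ∈ harmonics n l)
    (hg : g ∈ harmonics n l') (h : l ≠ l') : ∫ x, f x * g x ∂(sigma n) = 0 := by
  obtain ⟨p, hp, hp', rfl⟩ := mem_harmonics.1 hf
  obtain ⟨q, hq, hq', rfl⟩ := mem_harmonics.1 hg
  simp_rw [← restrictSphere_mul]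
  rw [integral_restrictSphere_of_isHomogeneous (hp.mul hq),
    gaussFunctional_mul_eq_zero hp hp' hq hq' h, mul_zero]

theorem conj_mem_harmonics {l : ℕ} {f : Sph n → ℂ} (hf : f ∈ harmonics n l) :
    (fun x => (starRingEnd ℂ) (f x)) ∈ harmonics n l := by
  obtain ⟨p, hp, hp', rfl⟩ := mem_harmonics.1 hf
  refine mem_harmonics.2 ⟨map (starRingEnd ℂ) p, hp.map _, ?_, funext fun x => ?_⟩
  · rw [laplacian_map_conj, hp', map_zero]
  · exact restrictSphere_map_conj p x

theorem sInner_harmonics_eq_zero {l l' : ℕ} {f g : Sph n → ℂ} (hf : f ∈ harmonics n l)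
    (hg : g ∈ harmonics n l') (h : l ≠ l') : sInner n f g = 0 := by
  rw [sInner, integral_mul_harmonics_eq_zero (conj_mem_harmonics hf) hg h, mul_zero]

/-- The quotient of the normalizing factors of the sphere integral in degrees `2l` and `0`; the
argument on the left is `λ + 1 + l`. -/
theorem Gamma_lam_add (hn : 2 ≤ n) (l : ℕ) :
    Real.Gamma (((l + l + n : ℕ) + 1) / 2) * lam n =
      (ascPochhammer ℝ l).eval (lam n) * (l + lam n) * Real.Gamma (((n : ℕ) + 1) / 2) := by
  induction l with
  | zero => simp; ring
  | succ l ih =>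
    have h1 : ((((l + 1) + (l + 1) + n : ℕ) : ℝ) + 1) / 2 =
        (((l + l + n : ℕ) : ℝ) + 1) / 2 + 1 := by push_cast; ring
    have h2 : (((l + l + n : ℕ) : ℝ) + 1) / 2 = (l + 1 : ℕ) + lam n := by
      unfold lam; push_cast; ring
    rw [h1, Real.Gamma_add_one (by positivity), ascPochhammer_succ_eval, mul_assoc, ih, h2]
    ring

/-- Zonal harmonics reproduce the harmonics of their degree. Of the powers of `x · y` in the
Gegenbauer polynomial, only the leading one is not orthogonal to the harmonics of degree `l`. -/
theorem integral_gegenbauer_mul (hn : 2 ≤ n) {l : ℕ} {f : Sph n → ℂ} (hf : f ∈ harmonics n l)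
    (y : Sph n) :
    ∫ x : Sph n, ((gegenbauer (lam n) l (inner ℝ x.1 y.1) : ℝ) : ℂ) * f x ∂(sigma n) =
      ((sphereArea n * (lam n / (l + lam n)) : ℝ) : ℂ) * f y := by
  obtain ⟨p, hp, hp', rfl⟩ := mem_harmonics.1 hf
  set ℓ := linForm fun i => ((y.1 i : ℝ) : ℂ) with hℓ
  have h1 : ∀ x : Sph n, ((gegenbauer (lam n) l (inner ℝ x.1 y.1) : ℝ) : ℂ) * restrictSphere n p x =
      ∑ k ∈ Finset.range (l / 2 + 1), ((gegenbauerCoeff (lam n) l k * 2 ^ (l - 2 * k) : ℝ) : ℂ) *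
        restrictSphere n (ℓ ^ (l - 2 * k) * p) x := by
    intro x
    rw [gegenbauer_eq_sum, Complex.ofReal_sum, Finset.sum_mul]
    refine Finset.sum_congr rfl fun k _ => ?_
    rw [restrictSphere_mul, restrictSphere_apply n (ℓ ^ _), map_pow, eval_linForm]
    push_cast
    ring
  simp_rw [h1]
  rw [integral_finsetSum _ fun k _ => (integrable_restrictSphere n _).const_mul _]
  have h2 : ∀ k, ∫ x, ((gegenbauerCoeff (lam n) l k * 2 ^ (l - 2 * k) : ℝ) : ℂ) *
        restrictSphere n (ℓ ^ (l - 2 * k) * p) x ∂(sigma n) =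
      ((gegenbauerCoeff (lam n) l k * 2 ^ (l - 2 * k) : ℝ) : ℂ) *
        (((2 / Real.Gamma (((l - 2 * k + l + n : ℕ) + 1) / 2) : ℝ) : ℂ) *
        if l - 2 * k = l then (l.factorial : ℂ) / 2 ^ l * restrictSphere n p y *
          gaussFunctional (n + 1) 1 else 0) := by
    intro k
    rw [integral_const_mul, integral_restrictSphere_of_isHomogeneous
      (((isHomogeneous_linForm _).pow _).mul hp),
      gaussFunctional_linForm_pow_mul _ _ l p (by omega) hp hp', one_mul]
    rfl
  simp_rw [h2]
  rw [Finset.sum_range_succ', Finset.sum_eq_zero, zero_add]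
  · have hΓ := Gamma_lam_add hn l
    have hΓ1 : Real.Gamma (((l + l + n : ℕ) + 1) / 2) ≠ 0 :=
      (Real.Gamma_pos_of_pos (by positivity)).ne'
    have hΓ2 : Real.Gamma (((n : ℕ) + 1) / 2) ≠ 0 :=
      (Real.Gamma_pos_of_pos (by positivity)).ne'
    have hlam := lam_pos hn
    have hl : (l : ℝ) + lam n ≠ 0 := by positivity
    have h3 : gegenbauerCoeff (lam n) l 0 * (2 / Real.Gamma (((l + l + n : ℕ) + 1) / 2)) *
        l.factorial = 2 / Real.Gamma (((n : ℕ) + 1) / 2) * (lam n / (l + lam n)) := by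
      have hfac : (l.factorial : ℝ) ≠ 0 := by positivity
      simp only [gegenbauerCoeff, pow_zero, one_mul, Nat.factorial_zero, Nat.cast_one, mul_zero,
        Nat.sub_zero]
      field_simp
      linear_combination -hΓ
    have h4 := congrArg (fun x : ℝ => (x : ℂ)) h3
    rw [mul_zero, Nat.sub_zero, if_pos rfl]
    rw [Complex.ofReal_mul (sphereArea n), sphereArea_eq_gaussFunctional_one]
    push_cast at h4 ⊢
    have h5 : (2 : ℂ) ^ l ≠ 0 := pow_ne_zero _ two_ne_zero
    field_simp at h4 ⊢
    linear_combination (restrictSphere n p y * gaussFunctional (n + 1) 1) * h4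
  · intro k hk
    have := Finset.mem_range.1 hk
    rw [if_neg (by omega), mul_zero, mul_zero]

/-! ### The scalar product on continuous functions -/

theorem sInner_conj_symm (f g : Sph n → ℂ) : (starRingEnd ℂ) (sInner n f g) = sInner n g f := by
  unfold sInner
  rw [map_mul, Complex.conj_ofReal, ← integral_conj]
  congr 2
  funext x
  simp [mul_comm]

theorem sInner_smul_right (f g : Sph n → ℂ) (c : ℂ) :
    sInner n f (c • g) = c * sInner n f g := by
  unfold sInner
  simp_rw [Pi.smul_apply, smul_eq_mul, mul_left_comm _ c]
  rw [integral_const_mul]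
  ring

theorem integrable_conj_mul {f g : Sph n → ℂ} (hf : Continuous f) (hg : Continuous g) :
    Integrable (fun x => (starRingEnd ℂ) (f x) * g x) (sigma n) :=
  integrable_of_continuous ((Complex.continuous_conj.comp hf).mul hg)

theorem sInner_sum_right {ι : Type*} (s : Finset ι) {f : Sph n → ℂ} {g : ι → Sph n → ℂ}
    (hf : Continuous f) (hg : ∀ i ∈ s, Continuous (g i)) :
    sInner n f (∑ i ∈ s, g i) = ∑ i ∈ s, sInner n f (g i) := by
  unfold sInner
  simp_rw [Finset.sum_apply, Finset.mul_sum]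
  rw [integral_finsetSum _ fun i hi => integrable_conj_mul hf (hg i hi), Finset.mul_sum]

theorem sInner_add_right {f g h : Sph n → ℂ} (hf : Continuous f) (hg : Continuous g)
    (hh : Continuous h) : sInner n f (g + h) = sInner n f g + sInner n f h := by
  unfold sInner
  simp_rw [Pi.add_apply, mul_add]
  rw [integral_add (integrable_conj_mul hf hg) (integrable_conj_mul hf hh), mul_add]

theorem sInner_self (hn : 2 ≤ n) (f : Sph n → ℂ) : sInner n f f = ((sNorm n f ^ 2 : ℝ) : ℂ) := by
  have h : sInner n f f = (((sphereArea n)⁻¹ * ∫ x, ‖f x‖ ^ 2 ∂(sigma n) : ℝ) : ℂ) := by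
    unfold sInner
    rw [Complex.ofReal_mul, ← integral_complex_ofReal]
    congr 2
    funext x
    rw [← Complex.normSq_eq_conj_mul_self, Complex.normSq_eq_norm_sq]
  have h0 : 0 ≤ (sphereArea n)⁻¹ * ∫ x, ‖f x‖ ^ 2 ∂(sigma n) :=
    mul_nonneg (inv_nonneg.2 (sphereArea_pos hn).le) (integral_nonneg fun x => by positivity)
  rw [sNorm, h, Complex.ofReal_re, Real.sq_sqrt h0]

theorem sNorm_nonneg (f : Sph n → ℂ) : 0 ≤ sNorm n f := Real.sqrt_nonneg _

/-! ### The scaling functions as reproducing kernels -/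

theorem scalingFun_eq_sum (j : ℕ) (y : Sph n) : scalingFun n j y =
    ∑ l ∈ Finset.range (2 ^ (j - 1)),
      (((Real.sqrt 2 ^ (n * j))⁻¹ * (((l : ℝ) + lam n) / lam n) : ℝ) : ℂ) •
        fun x : Sph n => ((gegenbauer (lam n) l (inner ℝ x.1 y.1) : ℝ) : ℂ) := by
  funext x
  rw [scalingFun, scalingKernel, Finset.sum_apply, Finset.mul_sum, Complex.ofReal_sum]
  refine Finset.sum_congr rfl fun l _ => ?_
  rw [Pi.smul_apply, smul_eq_mul]
  push_cast
  ring

theorem harmonics_le_samplingSpace {j l : ℕ} (hl : l < 2 ^ (j - 1)) :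
    harmonics n l ≤ samplingSpace n j :=
  le_iSup₂_of_le (f := fun l (_ : l ∈ Finset.range (2 ^ (j - 1))) => harmonics n l) l
    (Finset.mem_range.2 hl) le_rfl

theorem scalingFun_mem (j : ℕ) (y : Sph n) : scalingFun n j y ∈ samplingSpace n j := by
  rw [scalingFun_eq_sum]
  exact Submodule.sum_mem _ fun l hl => Submodule.smul_mem _ _
    (harmonics_le_samplingSpace (Finset.mem_range.1 hl) (zonal_mem_harmonics l y))

theorem exists_eq_sum_of_mem_samplingSpace {j : ℕ} {f : Sph n → ℂ} (hf : f ∈ samplingSpace n j) :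
    ∃ g : ℕ → Sph n → ℂ, (∀ l, g l ∈ harmonics n l) ∧
      f = ∑ l ∈ Finset.range (2 ^ (j - 1)), g l := by
  obtain ⟨μ, hμ⟩ := (Submodule.mem_iSup_finset_iff_exists_sum _ _).1 hf
  exact ⟨fun l => μ l, fun l => (μ l).2, hμ.symm⟩

theorem continuous_of_mem_samplingSpace {j : ℕ} {f : Sph n → ℂ} (hf : f ∈ samplingSpace n j) :
    Continuous f := by
  obtain ⟨g, hg, rfl⟩ := exists_eq_sum_of_mem_samplingSpace hf
  have h := continuous_finsetSum (Finset.range (2 ^ (j - 1))) fun l _ =>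
    continuous_of_mem_harmonics (hg l)
  convert h using 1
  funext x
  simp

theorem sInner_gegenbauer (hn : 2 ≤ n) {l : ℕ} {f : Sph n → ℂ} (hf : f ∈ harmonics n l)
    (y : Sph n) :
    sInner n f (fun x : Sph n => ((gegenbauer (lam n) l (inner ℝ x.1 y.1) : ℝ) : ℂ)) =
      ((lam n / (l + lam n) : ℝ) : ℂ) * (starRingEnd ℂ) (f y) := by
  have h := integral_gegenbauer_mul hn (conj_mem_harmonics hf) y
  rw [sInner]
  simp_rw [mul_comm ((starRingEnd ℂ) (f _))]
  rw [h, ← mul_assoc, ← Complex.ofReal_mul]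
  have := (sphereArea_pos hn).ne'
  congr 2
  field_simp

/-- The scaling function reproduces the harmonics of low degree and annihilates the others. -/
theorem sInner_harmonics_scalingFun (hn : 2 ≤ n) {j l : ℕ} {f : Sph n → ℂ}
    (hf : f ∈ harmonics n l) (y : Sph n) :
    sInner n f (scalingFun n j y) =
      if l < 2 ^ (j - 1) then (((Real.sqrt 2 ^ (n * j))⁻¹ : ℝ) : ℂ) * (starRingEnd ℂ) (f y)
      else 0 := by
  have hcont := continuous_of_mem_harmonics hf
  rw [scalingFun_eq_sum, sInner_sum_right _ hcont fun l' _ =>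
    (continuous_of_mem_harmonics (zonal_mem_harmonics l' y)).const_smul _]
  simp_rw [sInner_smul_right]
  have h1 : ∀ l', l' ≠ l → sInner n f
      (fun x : Sph n => ((gegenbauer (lam n) l' (inner ℝ x.1 y.1) : ℝ) : ℂ)) = 0 :=
    fun l' h => sInner_harmonics_eq_zero hf (zonal_mem_harmonics l' y) h.symm
  split_ifs with hl
  · rw [Finset.sum_eq_single_of_mem l (Finset.mem_range.2 hl) fun l' _ h => by
      rw [h1 l' h, mul_zero]]
    rw [sInner_gegenbauer hn hf, ← mul_assoc, ← Complex.ofReal_mul]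
    have h4 := lam_pos hn
    have h5 : (l : ℝ) + lam n ≠ 0 := by positivity
    congr 2
    field_simp
  · exact Finset.sum_eq_zero fun l' hl' => by
      have := Finset.mem_range.1 hl'
      rw [h1 l' (by omega), mul_zero]

/-- The reproducing property of the scaling function. -/
theorem sInner_scalingFun (hn : 2 ≤ n) {j : ℕ} {f : Sph n → ℂ} (hf : f ∈ samplingSpace n j)
    (y : Sph n) :
    sInner n (scalingFun n j y) f = (((Real.sqrt 2 ^ (n * j))⁻¹ : ℝ) : ℂ) * f y := by
  have hy := continuous_of_mem_samplingSpace (scalingFun_mem j y)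
  obtain ⟨g, hg, rfl⟩ := exists_eq_sum_of_mem_samplingSpace hf
  rw [sInner_sum_right _ hy fun l _ => continuous_of_mem_harmonics (hg l), Finset.sum_apply,
    Finset.mul_sum]
  refine Finset.sum_congr rfl fun l hl => ?_
  rw [← sInner_conj_symm, sInner_harmonics_scalingFun hn (hg l), if_pos (Finset.mem_range.1 hl)]
  simp

end

section

/-! ### Separation of variables in spherical coordinates -/

open MvPolynomial

variable {n : ℕ}

/-- The polynomial `∑_{m ≥ i} x_m²`. -/
noncomputable def tailSq (n i : ℕ) : MvPolynomial (Fin (n + 1)) ℂ :=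
  ∑ m : Fin (n + 1), if i ≤ (m : ℕ) then X m ^ 2 else 0

theorem pderiv_tailSq (i : ℕ) (m : Fin (n + 1)) :
    pderiv m (tailSq n i) = if i ≤ (m : ℕ) then 2 * X m else 0 := by
  simp only [tailSq, map_sum]
  rw [Finset.sum_eq_single m]
  · split_ifs <;> simp
  · intro b _ hb
    split_ifs
    · simp [hb]
    · simp
  · simp

theorem isHomogeneous_tailSq (i : ℕ) : (tailSq n i).IsHomogeneous 2 :=
  IsHomogeneous.sum _ _ _ fun m _ => by
    split_ifs
    · simpa using (isHomogeneous_X ℂ m).pow 2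
    · exact isHomogeneous_zero _ _ _

theorem gradDeriv_tailSq_self (i : ℕ) : gradDeriv (tailSq n i) (tailSq n i) = 4 * tailSq n i := by
  simp only [gradDeriv_apply, pderiv_tailSq]
  rw [tailSq, Finset.mul_sum]
  refine Finset.sum_congr rfl fun m _ => ?_
  split_ifs
  · ring
  · simp

theorem laplacian_tailSq {i : ℕ} (hi : i ≤ n) :
    laplacian n (tailSq n i) = C (2 * ((n : ℂ) + 1 - i)) := by
  have h1 : ∀ m : Fin (n + 1), pderiv m (pderiv m (tailSq n i)) =
      C (if i ≤ (m : ℕ) then (2 : ℂ) else 0) := by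
    intro m
    have h2 : (2 : MvPolynomial (Fin (n + 1)) ℂ) = C 2 := by rw [map_ofNat]
    rw [pderiv_tailSq]
    split_ifs
    · rw [h2, pderiv_C_mul, pderiv_X_self, mul_one]
    · simp
  rw [laplacian_apply, Finset.sum_congr rfl fun m _ => h1 m, ← map_sum,
    Fin.sum_univ_eq_sum_range (fun m => if i ≤ m then (2 : ℂ) else 0) (n + 1),
    ← Finset.sum_filter, Finset.sum_const]
  have : ((Finset.range (n + 1)).filter fun m => i ≤ m) = Finset.Ico i (n + 1) := by
    ext m
    simp only [Finset.mem_filter, Finset.mem_range, Finset.mem_Ico]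
    omega
  rw [this, Nat.card_Ico, nsmul_eq_mul, Nat.cast_sub (by omega)]
  push_cast
  ring_nf

theorem pderiv_homGegenbauer (μ : ℝ) (m : ℕ) {u R : MvPolynomial (Fin (n + 1)) ℂ}
    {i : Fin (n + 1)} (hu : pderiv i u = 0) (hR : pderiv i R = 0) :
    pderiv i (homGegenbauer μ m u R) = 0 := by
  have h2 : pderiv i (2 * u) = 0 := by
    rw [← map_ofNat (C : ℂ →+* MvPolynomial (Fin (n + 1)) ℂ) 2, pderiv_C_mul, hu, mul_zero]
  rw [homGegenbauer, map_sum]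
  exact Finset.sum_eq_zero fun k _ => by
    rw [pderiv_C_mul, pderiv_mul, pderiv_pow, pderiv_pow, hR, h2]
    simp

/-- The distance of `x` to the subspace where the coordinates from `i` on vanish. -/
noncomputable def tailNorm (n : ℕ) (x : Sph n) (i : ℕ) : ℝ :=
  Real.sqrt (∑ m : Fin (n + 1), if i ≤ (m : ℕ) then x.1 m ^ 2 else 0)

theorem tailNorm_sq (x : Sph n) (i : ℕ) :
    tailNorm n x i ^ 2 = ∑ m : Fin (n + 1), if i ≤ (m : ℕ) then x.1 m ^ 2 else 0 :=
  Real.sq_sqrt (Finset.sum_nonneg fun m _ => by split_ifs <;> positivity)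

theorem tailNorm_nonneg (x : Sph n) (i : ℕ) : 0 ≤ tailNorm n x i := Real.sqrt_nonneg _

theorem tailNorm_sq_succ (x : Sph n) (i : Fin (n + 1)) :
    tailNorm n x i ^ 2 = x.1 i ^ 2 + tailNorm n x (i + 1) ^ 2 := by
  rw [tailNorm_sq, tailNorm_sq, ← Finset.add_sum_erase _ _ (Finset.mem_univ i),
    ← Finset.add_sum_erase Finset.univ
      (fun m : Fin (n + 1) => if (i : ℕ) + 1 ≤ (m : ℕ) then x.1 m ^ 2 else 0)
      (Finset.mem_univ i), if_pos le_rfl, if_neg (by omega), zero_add]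
  congr 1
  refine Finset.sum_congr rfl fun m hm => ?_
  have : (m : ℕ) ≠ i := fun h => Finset.ne_of_mem_erase hm (Fin.ext h)
  congr 1
  rw [eq_iff_iff]
  omega

theorem eval_tailSq (x : Sph n) (i : ℕ) :
    eval (fun m => ((x.1 m : ℝ) : ℂ)) (tailSq n i) = (tailNorm n x i ^ 2 : ℝ) := by
  rw [tailNorm_sq, tailSq, map_sum, Complex.ofReal_sum]
  refine Finset.sum_congr rfl fun m _ => ?_
  split_ifs <;> simp

/-- The polar angles, as functions of a natural number. -/
noncomputable def polarAngleNat (n : ℕ) (x : Sph n) (i : ℕ) : ℝ :=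
  if h : i < n - 1 then polarAngle n x ⟨i, h⟩ else 0

/-- At the points where a polar angle is indeterminate both sides vanish. -/
theorem coord_eq_tailNorm_mul_cos (x : Sph n) {i : ℕ} (hi : i < n - 1) :
    x.1 ⟨i, by omega⟩ = tailNorm n x i * Real.cos (polarAngleNat n x i) := by
  have h := tailNorm_sq_succ x ⟨i, by omega⟩
  have h0 := tailNorm_nonneg x i
  simp only at h
  have habs : |x.1 ⟨i, by omega⟩| ≤ tailNorm n x i :=
    abs_le_of_sq_le_sq (by nlinarith [sq_nonneg (tailNorm n x (i + 1))]) h0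
  have hθ : polarAngleNat n x i = Real.arccos (x.1 ⟨i, by omega⟩ / tailNorm n x i) := by
    rw [polarAngleNat, dif_pos hi]
    rfl
  rcases h0.eq_or_lt with h1 | h1
  · rw [← h1] at habs ⊢
    rw [zero_mul]
    exact abs_nonpos_iff.1 habs
  · rw [hθ, Real.cos_arccos]
    · field_simp
    · rw [le_div_iff₀ h1]
      linarith [(abs_le.1 habs).1]
    · rw [div_le_one h1]
      exact (abs_le.1 habs).2

theorem tailNorm_succ_eq (x : Sph n) {i : ℕ} (hi : i < n - 1) :
    tailNorm n x (i + 1) = tailNorm n x i * Real.sin (polarAngleNat n x i) := by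
  have h := tailNorm_sq_succ x ⟨i, by omega⟩
  have hc := coord_eq_tailNorm_mul_cos x hi
  have hs : 0 ≤ Real.sin (polarAngleNat n x i) := by
    rw [polarAngleNat, dif_pos hi]
    exact Real.sin_nonneg_of_nonneg_of_le_pi (Real.arccos_nonneg _) (Real.arccos_le_pi _)
  rw [← sq_eq_sq₀ (tailNorm_nonneg x _) (mul_nonneg (tailNorm_nonneg x _) hs)]
  simp only [hc] at h
  nlinarith [Real.sin_sq_add_cos_sq (polarAngleNat n x i)]

theorem tailNorm_mul_exp_azimuth (hn : 2 ≤ n) (x : Sph n) :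
    (tailNorm n x (n - 1) : ℂ) * Complex.exp (azimuth n x * Complex.I) =
      x.1 ⟨n - 1, by omega⟩ + x.1 ⟨n, by omega⟩ * Complex.I := by
  have h1 := tailNorm_sq_succ x ⟨n - 1, by omega⟩
  have h2 := tailNorm_sq_succ x ⟨n, by omega⟩
  have h3 : tailNorm n x (n + 1) = 0 := by
    rw [tailNorm, Finset.sum_eq_zero fun m _ => if_neg (by omega), Real.sqrt_zero]
  simp only [Nat.sub_add_cancel (by omega : 1 ≤ n)] at h1
  simp only [h3] at h2
  have h4 : tailNorm n x (n - 1) = ‖(⟨x.1 ⟨n - 1, by omega⟩, x.1 ⟨n, by omega⟩⟩ : ℂ)‖ := by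
    rw [Complex.norm_def, Complex.normSq_mk, ← Real.sqrt_sq (tailNorm_nonneg x (n - 1)), h1, h2]
    congr 1
    ring
  rw [h4, azimuth, Complex.norm_mul_exp_arg_mul_I, Complex.mk_eq_add_mul_I]

/-- The harmonic polynomials `(x_{n-1} ± i x_n)^q` of the last two coordinates. -/
theorem exists_harmonic_of_azimuth (hn : 2 ≤ n) (k : ℤ) :
    ∃ p : MvPolynomial (Fin (n + 1)) ℂ, p.IsHomogeneous k.natAbs ∧ laplacian n p = 0 ∧
      (∀ m : Fin (n + 1), (m : ℕ) < n - 1 → pderiv m p = 0) ∧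
      ∀ x : Sph n, restrictSphere n p x = (tailNorm n x (n - 1) : ℂ) ^ k.natAbs *
        Complex.exp (Complex.I * (k : ℂ) * (azimuth n x : ℂ)) := by
  have key : ∀ (q : ℕ) (s : ℂ), s * s = -1 → ∃ p : MvPolynomial (Fin (n + 1)) ℂ,
      p.IsHomogeneous q ∧ laplacian n p = 0 ∧
      (∀ m : Fin (n + 1), (m : ℕ) < n - 1 → pderiv m p = 0) ∧
      ∀ x : Sph n, restrictSphere n p x =
        (x.1 ⟨n - 1, by omega⟩ + s * x.1 ⟨n, by omega⟩) ^ q := by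
    intro q s hs
    set y : Fin (n + 1) → ℂ := fun i => if (i : ℕ) = n - 1 then 1 else if (i : ℕ) = n then s else 0
      with hy
    have hsum : ∀ f : Fin (n + 1) → ℂ, (∑ i, y i * f i) =
        f ⟨n - 1, by omega⟩ + s * f ⟨n, by omega⟩ := by
      intro f
      rw [Finset.sum_eq_add (⟨n - 1, by omega⟩ : Fin (n + 1)) ⟨n, by omega⟩
        (by simp [Fin.ext_iff]; omega)]
      · have : n ≠ n - 1 := by omega
        simp [hy, this]
      · rintro c - ⟨h1, h2⟩
        rw [Ne, Fin.ext_iff] at h1 h2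
        simp only at h1 h2
        simp [hy, h1, h2]
      · simp
      · simp
    have hyy : gradDeriv (linForm y) (linForm y) = 0 := by
      simp only [gradDeriv_linForm, pderiv_linForm, ← map_mul, ← map_sum, hsum]
      have : n ≠ n - 1 := by omega
      simp [hy, this, hs]
    refine ⟨linForm y ^ q, by simpa using (isHomogeneous_linForm y).pow q, ?_, ?_, ?_⟩
    · rw [laplacian_pow, hyy]
      simp [laplacian_apply, pderiv_linForm]
    · intro m hm
      rw [pderiv_pow, pderiv_linForm, hy]
      simp [show (m : ℕ) ≠ n - 1 by omega, show (m : ℕ) ≠ n by omega]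
    · intro x
      rw [restrictSphere_apply, map_pow]
      congr 1
      simp only [linForm, map_sum, map_mul, eval_C, eval_X]
      exact hsum _
  have hexp := tailNorm_mul_exp_azimuth hn
  rcases Int.natAbs_eq k with hk | hk
  · obtain ⟨p, h1, h2, h3, h4⟩ := key k.natAbs Complex.I (by simp)
    refine ⟨p, h1, h2, h3, fun x => ?_⟩
    rw [h4, mul_comm Complex.I (x.1 _ : ℂ), ← hexp, mul_pow, ← Complex.exp_nat_mul]
    have hk' : (k : ℂ) = (k.natAbs : ℂ) := by
      conv_lhs => rw [hk]
      rw [Int.cast_natCast]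
    rw [hk']
    congr 2
    ring
  · obtain ⟨p, h1, h2, h3, h4⟩ := key k.natAbs (-Complex.I) (by simp)
    refine ⟨p, h1, h2, h3, fun x => ?_⟩
    have h5 := congrArg (starRingEnd ℂ) (hexp x)
    simp only [map_add, map_mul, ← Complex.exp_conj, Complex.conj_ofReal, Complex.conj_I] at h5
    rw [h4, mul_comm (-Complex.I) (x.1 _ : ℂ), ← h5, mul_pow, ← Complex.exp_nat_mul]
    have hk' : (k : ℂ) = -(k.natAbs : ℂ) := by
      conv_lhs => rw [hk]
      rw [Int.cast_neg, Int.cast_natCast]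
    rw [hk']
    congr 2
    ring

/-- Separation of variables: starting from the last two coordinates, the remaining ones are added
one by one, each contributing a homogenized Gegenbauer factor. -/
theorem exists_harmonic_of_tail (hn : 2 ≤ n) (q : ℕ → ℕ) (hq : ∀ i, q (i + 1) ≤ q i) (k : ℤ)
    (hk : k.natAbs = q (n - 1)) (r : ℕ) : ∀ i, i + r = n - 1 →
    ∃ p : MvPolynomial (Fin (n + 1)) ℂ, p.IsHomogeneous (q i) ∧ laplacian n p = 0 ∧
      (∀ m : Fin (n + 1), (m : ℕ) < i → pderiv m p = 0) ∧
      ∀ x : Sph n, restrictSphere n p x = (tailNorm n x i : ℂ) ^ q i *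
        (((∏ m ∈ Finset.Ico i (n - 1),
          (gegenbauer (((n : ℝ) - 1 - m) / 2 + q (m + 1)) (q m - q (m + 1))
            (Real.cos (polarAngleNat n x m)) *
            Real.sin (polarAngleNat n x m) ^ q (m + 1)) : ℝ) : ℂ) *
        Complex.exp (Complex.I * (k : ℂ) * (azimuth n x : ℂ))) := by
  induction r with
  | zero =>
    intro i hi
    obtain rfl : i = n - 1 := by omega
    rw [← hk]
    simpa using exists_harmonic_of_azimuth hn k
  | succ r ih =>
    intro i hi
    obtain ⟨p, h1, h2, h3, h4⟩ := ih (i + 1) (by omega)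
    set i' : Fin (n + 1) := ⟨i, by omega⟩
    set μ : ℝ := ((n : ℝ) - 1 - i) / 2 + q (i + 1) with hμ
    refine ⟨p * homGegenbauer μ (q i - q (i + 1)) (X i') (tailSq n i), ?_, ?_, ?_, ?_⟩
    · have := h1.mul (isHomogeneous_homGegenbauer μ (q i - q (i + 1)) (isHomogeneous_X ℂ i')
        (isHomogeneous_tailSq i))
      rwa [Nat.add_sub_cancel' (hq i)] at this
    · have hX : ∀ g : MvPolynomial (Fin (n + 1)) ℂ, gradDeriv (X i') g = pderiv i' g := by
        intro g
        simp [gradDeriv_apply, pderiv_X, Pi.single_apply]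
      refine laplacian_mul_homGegenbauer (D := (n : ℂ) + 1 - i) (q := q (i + 1)) ?_ ?_ ?_ ?_
        (gradDeriv_tailSq_self i) (laplacian_tailSq (by omega)) h2 ?_ ?_ _
      · rw [hμ]
        push_cast
        ring
      · rw [laplacian_apply]
        refine Finset.sum_eq_zero fun m _ => ?_
        rw [pderiv_X, Pi.single_apply]
        split_ifs <;> simp
      · rw [hX, pderiv_X_self]
      · rw [hX, pderiv_tailSq, if_pos le_rfl]
      · rw [gradDeriv_comm, hX]
        exact h3 i' (Nat.lt_succ_self i)
      · rw [gradDeriv_apply]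
        have h5 : ∀ m, pderiv m p * pderiv m (tailSq n i) = 2 * (X m * pderiv m p) := by
          intro m
          rw [pderiv_tailSq]
          split_ifs with h
          · ring
          · rw [h3 m (by omega)]
            simp
        rw [Finset.sum_congr rfl fun m _ => h5 m, ← Finset.mul_sum, h1.sum_X_mul_pderiv]
        simp only [nsmul_eq_mul, map_mul, map_ofNat, map_natCast]
        ring
    · intro m hm
      rw [pderiv_mul, h3 m (by omega), pderiv_homGegenbauer, zero_mul, mul_zero, add_zero]
      · exact pderiv_X_of_ne fun h => by
          rw [← h] at hm
          exact lt_irrefl _ hm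
      · rw [pderiv_tailSq, if_neg (by omega)]
    · intro x
      rw [restrictSphere_mul, h4, restrictSphere_apply n (homGegenbauer _ _ _ _),
        eval_homGegenbauer μ _ _ _ _ (tailNorm n x i) (Real.cos (polarAngleNat n x i)) ?_
          (eval_tailSq x i), tailNorm_succ_eq x (by omega : i < n - 1),
        Finset.prod_eq_prod_Ico_succ_bot (by omega : i < n - 1)]
      · have h5 : (tailNorm n x i : ℂ) ^ q i =
            (tailNorm n x i : ℂ) ^ q (i + 1) * (tailNorm n x i : ℂ) ^ (q i - q (i + 1)) := by
          rw [← pow_add, Nat.add_sub_cancel' (hq i)]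
        rw [h5]
        push_cast
        ring
      · rw [eval_X, coord_eq_tailNorm_mul_cos x (by omega : i < n - 1)]

theorem harmonicRaw_mem_harmonics (hn : 2 ≤ n) (k : HarmonicIndex n) :
    harmonicRaw n hn k ∈ harmonics n (k.degree hn) := by
  set q : ℕ → ℕ := fun i => if h : i < n then (k.1 ⟨i, h⟩).natAbs else 0 with hqdef
  have hq' : ∀ i (h : i < n), q i = (k.1 ⟨i, h⟩).natAbs := fun i h => by rw [hqdef]; exact dif_pos h
  have hk : ∀ i (h : i + 1 < n), ((k.1 ⟨i + 1, h⟩).natAbs : ℤ) ≤ k.1 ⟨i, by omega⟩ := by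
    intro i h
    rw [← Int.abs_eq_natAbs]
    exact k.2 _ _ (by simp [Fin.lt_def])
  have hq : ∀ i, q (i + 1) ≤ q i := by
    intro i
    by_cases h : i + 1 < n
    · have := hk i h
      rw [hq' i (by omega), hq' (i + 1) h]
      omega
    · simp [hqdef, h]
  obtain ⟨p, h1, h2, -, h4⟩ := exists_harmonic_of_tail hn q hq (k.1 ⟨n - 1, by omega⟩)
    (hq' (n - 1) (by omega)).symm (n - 1) 0 (by omega)
  have h0 : q 0 = k.degree hn := by
    have := hk 0 (by omega)
    rw [hq' 0 (by omega), HarmonicIndex.degree]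
    omega
  rw [mem_harmonics]
  refine ⟨p, h0 ▸ h1, h2, ?_⟩
  funext x
  have hρ : tailNorm n x 0 = 1 := by
    rw [tailNorm, Real.sqrt_eq_one]
    simpa using sum_sq_eq_one x
  rw [h4, hρ, harmonicRaw, Complex.ofReal_one, one_pow, one_mul]
  congr 2
  rw [← Finset.range_eq_Ico, Finset.prod_range]
  refine Finset.prod_congr rfl fun i _ => ?_
  have h5 := hk i (by omega)
  rw [hq' i (by omega), hq' (i + 1) (by omega), polarAngleNat, dif_pos i.2]
  rw [Int.abs_eq_natAbs]
  congr 3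
  omega

theorem harmonicY_mem_harmonics (hn : 2 ≤ n) (k : HarmonicIndex n) :
    harmonicY n hn k ∈ harmonics n (k.degree hn) :=
  Submodule.smul_mem _ _ (harmonicRaw_mem_harmonics hn k)

end

section

/-! ### One-dimensional quadrature -/

/-- Orthogonality on `2M` equidistant points of the circle, as a sum of roots of unity. -/
theorem sum_cos_circle {M : ℕ} (hM : 0 < M) (k : ℤ) :
    ∑ t ∈ Finset.range (2 * M), Real.cos (k * (t * Real.pi / M)) =
      if ((2 * M : ℕ) : ℤ) ∣ k then 2 * (M : ℝ) else 0 := by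
  have hM' : (M : ℂ) ≠ 0 := by exact_mod_cast hM.ne'
  set ζ : ℂ := Complex.exp (2 * Real.pi * Complex.I / (2 * M : ℕ)) ^ k with hζ
  have hprim := Complex.isPrimitiveRoot_exp (2 * M) (by omega)
  have h1 : ∀ t : ℕ, Real.cos (k * (t * Real.pi / M)) = (ζ ^ t).re := by
    intro t
    rw [hζ, ← Complex.exp_int_mul, ← Complex.exp_nat_mul, ← Complex.exp_ofReal_mul_I_re]
    congr 2
    push_cast
    field_simp
  simp_rw [h1]
  rw [← Complex.re_sum]
  split_ifs with h
  · rw [show ζ = 1 from (hprim.zpow_eq_one_iff_dvd k).2 h]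
    simp
  · have h2 : ζ ≠ 1 := fun h' => h ((hprim.zpow_eq_one_iff_dvd k).1 h')
    rw [geom_sum_eq h2]
    have h3 : ζ ^ (2 * M) = 1 := by
      rw [hζ, ← zpow_natCast, zpow_comm, zpow_natCast, hprim.pow_eq_one, one_zpow]
    simp [h3]

/-- Folding a sum over the full circle to one over the half circle. -/
theorem sum_range_eq_two_mul_sum_quadEps {M : ℕ} (hM : 0 < M) (f : ℕ → ℝ)
    (hf : ∀ t, 0 < t → t ≤ M → f (2 * M - t) = f t) :
    ∑ t ∈ Finset.range (2 * M), f t =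
      2 * ∑ u ∈ Finset.range (M + 1), quadEps M u * f u := by
  obtain ⟨m, rfl⟩ : ∃ m, M = m + 1 := ⟨M - 1, by omega⟩
  have h1 : ∑ t ∈ Finset.range (m + 1), f (m + 1 + t) = ∑ t ∈ Finset.range (m + 1), f (t + 1) := by
    rw [← Finset.sum_range_reflect]
    refine Finset.sum_congr rfl fun t ht => ?_
    have := Finset.mem_range.1 ht
    rw [← hf (t + 1) (by omega) (by omega)]
    congr 1
    omega
  have h2 : ∑ u ∈ Finset.range m, quadEps (m + 1) (u + 1) * f (u + 1) =
      ∑ u ∈ Finset.range m, f (u + 1) := by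
    refine Finset.sum_congr rfl fun u hu => ?_
    have := Finset.mem_range.1 hu
    rw [quadEps, if_neg (by omega), one_mul]
  rw [two_mul (m + 1), Finset.sum_range_add, h1, Finset.sum_range_succ', Finset.sum_range_succ,
    Finset.sum_range_succ _ (m + 1), Finset.sum_range_succ', h2]
  simp only [quadEps, true_or, or_true, if_true]
  ring

theorem sum_quadEps_cos {M : ℕ} (hM : 0 < M) (k : ℤ) :
    ∑ u ∈ Finset.range (M + 1), quadEps M u * Real.cos (k * (u * Real.pi / M)) =
      if ((2 * M : ℕ) : ℤ) ∣ k then (M : ℝ) else 0 := by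
  have h := sum_range_eq_two_mul_sum_quadEps hM
    (fun t => Real.cos (k * (t * Real.pi / M))) (by
      intro t _ ht
      have hM' : (M : ℝ) ≠ 0 := by exact_mod_cast hM.ne'
      rw [← Real.cos_neg, ← Real.cos_add_int_mul_two_pi _ k, Nat.cast_sub (by omega)]
      congr 1
      push_cast
      field_simp
      ring)
  rw [sum_cos_circle hM] at h
  split_ifs at h ⊢ <;> linarith

/-- Discrete orthogonality of the cosines. -/
theorem sum_quadEps_cos_mul_cos {M a k : ℕ} (hM : 0 < M) (ha : a ≤ M) (hk : k ≤ M) :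
    ∑ u ∈ Finset.range (M + 1), quadEps M u *
        (Real.cos (a * (u * Real.pi / M)) * Real.cos (k * (u * Real.pi / M))) =
      if a = k then (M : ℝ) / (2 * quadEps M a) else 0 := by
  have h1 : ∀ u : ℕ, quadEps M u *
        (Real.cos (a * (u * Real.pi / M)) * Real.cos (k * (u * Real.pi / M))) =
      1 / 2 * (quadEps M u * Real.cos (((a - k : ℤ) : ℝ) * (u * Real.pi / M))) +
      1 / 2 * (quadEps M u * Real.cos (((a + k : ℤ) : ℝ) * (u * Real.pi / M))) := by
    intro u
    push_cast
    rw [sub_mul, add_mul, Real.cos_sub, Real.cos_add]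
    ring
  simp_rw [h1]
  rw [Finset.sum_add_distrib, ← Finset.mul_sum, ← Finset.mul_sum, sum_quadEps_cos hM,
    sum_quadEps_cos hM]
  have h2 : (((2 * M : ℕ) : ℤ) ∣ (a : ℤ) - k) ↔ a = k := by
    constructor
    · intro h
      have := Int.eq_zero_of_abs_lt_dvd h (by rw [abs_lt]; omega)
      omega
    · rintro rfl
      simp
  have h3 : (((2 * M : ℕ) : ℤ) ∣ (a : ℤ) + k) ↔ (a = k ∧ (a = 0 ∨ a = M)) := by
    constructor
    · rintro ⟨c, hc⟩
      have hc0 : 0 ≤ c := by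
        by_contra h
        have : ((2 * M : ℕ) : ℤ) * c < 0 := mul_neg_of_pos_of_neg (by omega) (by omega)
        omega
      have hc1 : c ≤ 1 := by
        by_contra h
        have : ((2 * M : ℕ) : ℤ) * 2 ≤ ((2 * M : ℕ) : ℤ) * c :=
          mul_le_mul_of_nonneg_left (by omega) (by omega)
        omega
      interval_cases c <;> omega
    · rintro ⟨rfl, rfl | rfl⟩
      · simp
      · exact ⟨1, by push_cast; ring⟩
  simp only [h2, h3]
  by_cases h : a = k
  · by_cases h' : a = 0 ∨ a = M
    · simp only [quadEps, h, true_and, if_true, if_pos (h ▸ h' : k = 0 ∨ k = M)]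
      ring
    · simp only [quadEps, h, true_and, if_true, if_neg (h ▸ h' : ¬(k = 0 ∨ k = M))]
      ring
  · simp [h]

/-- The trigonometric polynomials spanned by `cos (k θ)`, `k ≤ N`. -/
def cosSpan (N : ℕ) : Submodule ℝ (ℝ → ℝ) :=
  Submodule.span ℝ {f | ∃ k : ℕ, k ≤ N ∧ f = fun θ => Real.cos (k * θ)}

theorem cosSpan_mono {N N' : ℕ} (h : N ≤ N') : cosSpan N ≤ cosSpan N' :=
  Submodule.span_mono fun _ ⟨k, hk, hf⟩ => ⟨k, hk.trans h, hf⟩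

theorem cos_mul_mem_cosSpan {N : ℕ} {f : ℝ → ℝ} (hf : f ∈ cosSpan N) :
    (fun θ => Real.cos θ * f θ) ∈ cosSpan (N + 1) := by
  induction hf using Submodule.span_induction with
  | mem f hf =>
    obtain ⟨k, hk, rfl⟩ := hf
    rcases k with _ | k
    · exact Submodule.subset_span ⟨1, by omega, by simp⟩
    · have h : (fun θ => Real.cos θ * Real.cos ((k + 1 : ℕ) * θ)) =
          (1 / 2 : ℝ) • ((fun θ => Real.cos ((k + 2 : ℕ) * θ)) + fun θ => Real.cos (k * θ)) := by
        funext θ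
        simp only [Pi.smul_apply, Pi.add_apply, smul_eq_mul]
        rw [show ((k + 2 : ℕ) : ℝ) * θ = (k + 1 : ℕ) * θ + θ by push_cast; ring,
          show (k : ℝ) * θ = (k + 1 : ℕ) * θ - θ by push_cast; ring, Real.cos_add, Real.cos_sub]
        ring
      rw [h]
      exact Submodule.smul_mem _ _ (Submodule.add_mem _
        (Submodule.subset_span ⟨k + 2, by omega, rfl⟩) (Submodule.subset_span ⟨k, by omega, rfl⟩))
  | zero =>
    simp only [Pi.zero_apply, mul_zero]
    exact (cosSpan (N + 1)).zero_mem
  | add f g _ _ hf hg =>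
    convert! Submodule.add_mem _ hf hg using 1
    funext θ
    simp [mul_add]
  | smul c f _ hf =>
    convert! Submodule.smul_mem _ c hf using 1
    funext θ
    simp [mul_left_comm]

theorem cos_pow_mul_sin_pow_mem_cosSpan (a b : ℕ) :
    (fun θ => Real.cos θ ^ a * Real.sin θ ^ (2 * b)) ∈ cosSpan (a + 2 * b) := by
  induction b with
  | zero =>
    induction a with
    | zero => exact Submodule.subset_span ⟨0, le_rfl, by simp⟩
    | succ a ih =>
      convert! cos_mul_mem_cosSpan ih using 1
      funext θ
      ring
  | succ b ih =>
    have h := Submodule.sub_mem _ (cosSpan_mono (by omega : a + 2 * b ≤ a + 2 * (b + 1)) ih)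
      (cosSpan_mono (by omega : a + 2 * b + 1 + 1 ≤ a + 2 * (b + 1))
        (cos_mul_mem_cosSpan (cos_mul_mem_cosSpan ih)))
    convert! h using 1
    funext θ
    simp only [Pi.sub_apply]
    rw [show 2 * (b + 1) = 2 * b + 2 by ring, pow_add _ (2 * b), Real.sin_sq]
    ring

theorem continuous_of_mem_cosSpan {N : ℕ} {f : ℝ → ℝ} (hf : f ∈ cosSpan N) : Continuous f := by
  induction hf using Submodule.span_induction with
  | mem f hf =>
    obtain ⟨k, -, rfl⟩ := hf
    fun_prop
  | zero => exact continuous_const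
  | add f g _ _ hf hg => exact hf.add hg
  | smul c f _ hf => exact hf.const_smul c

/-- A quadrature formula which is exact on cosines is exact on their span. -/
theorem quadrature_of_cos {N : ℕ} {M : ℕ} {χ : ℕ → ℝ} {w : ℝ → ℝ} (hw : Continuous w)
    (h : ∀ k : ℕ, k ≤ N → ∑ u ∈ Finset.range (M + 1), χ u * Real.cos (k * (u * Real.pi / M)) =
      ∫ θ in (0 : ℝ)..Real.pi, Real.cos (k * θ) * w θ) {f : ℝ → ℝ} (hf : f ∈ cosSpan N) :
    ∑ u ∈ Finset.range (M + 1), χ u * f (u * Real.pi / M) =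
      ∫ θ in (0 : ℝ)..Real.pi, f θ * w θ := by
  induction hf using Submodule.span_induction with
  | mem f hf =>
    obtain ⟨k, hk, rfl⟩ := hf
    exact h k hk
  | zero => simp
  | add f g hf' hg' hf hg =>
    have hf'' := continuous_of_mem_cosSpan hf'
    have hg'' := continuous_of_mem_cosSpan hg'
    simp only [Pi.add_apply, mul_add, add_mul, Finset.sum_add_distrib, hf, hg]
    exact (intervalIntegral.integral_add ((hf''.mul hw).intervalIntegrable _ _)
      ((hg''.mul hw).intervalIntegrable _ _)).symm
  | smul c f _ hf =>
    simp only [Pi.smul_apply, smul_eq_mul, mul_left_comm _ c, ← Finset.mul_sum, hf, mul_assoc]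
    rw [intervalIntegral.integral_const_mul]

theorem integral_cos_odd_mul_sin_pow {k : ℕ} (hk : Odd k) (α : ℕ) :
    ∫ θ in (0 : ℝ)..Real.pi, Real.cos (k * θ) * Real.sin θ ^ α = 0 := by
  have h := intervalIntegral.integral_comp_sub_left (a := 0) (b := Real.pi)
    (fun θ => Real.cos (k * θ) * Real.sin θ ^ α) Real.pi
  simp only [sub_self, sub_zero, Real.sin_pi_sub, mul_sub, Real.cos_nat_mul_pi_sub, hk.neg_one_pow,
    neg_mul, one_mul, intervalIntegral.integral_neg] at h
  linarith

theorem integral_sin_pow_eq_Gamma (m : ℕ) :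
    ∫ θ in (0 : ℝ)..Real.pi, Real.sin θ ^ m =
      Real.sqrt Real.pi * Real.Gamma (((m : ℝ) + 1) / 2) / Real.Gamma ((m : ℝ) / 2 + 1) := by
  have key : ∀ m : ℕ, (∫ θ in (0 : ℝ)..Real.pi, Real.sin θ ^ m =
      Real.sqrt Real.pi * Real.Gamma (((m : ℝ) + 1) / 2) / Real.Gamma ((m : ℝ) / 2 + 1)) ∧
      (∫ θ in (0 : ℝ)..Real.pi, Real.sin θ ^ (m + 1) =
      Real.sqrt Real.pi * Real.Gamma (((m + 1 : ℕ) + 1) / 2) /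
        Real.Gamma (((m + 1 : ℕ) : ℝ) / 2 + 1)) := by
    intro m
    induction m with
    | zero =>
      have hpi : 0 < Real.sqrt Real.pi := Real.sqrt_pos.2 Real.pi_pos
      refine ⟨?_, ?_⟩
      · simp [← Real.Gamma_one_half_eq]
        rw [← one_div, Real.Gamma_one_half_eq, Real.mul_self_sqrt Real.pi_pos.le]
      · have h : ((((0 + 1 : ℕ) : ℝ)) + 1) / 2 = 1 := by norm_num
        rw [h, Real.Gamma_one, Real.Gamma_add_one (by norm_num)]
        norm_num [Real.Gamma_one_half_eq]
        field_simp
    | succ m ih =>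
      refine ⟨ih.2, ?_⟩
      rw [integral_sin_pow, ih.1]
      have h1 : (((m + 1 + 1 : ℕ) : ℝ) + 1) / 2 = ((m : ℝ) + 1) / 2 + 1 := by push_cast; ring
      have h2 : ((m + 1 + 1 : ℕ) : ℝ) / 2 + 1 = ((m : ℝ) / 2 + 1) + 1 := by push_cast; ring
      have h3 := Real.Gamma_pos_of_pos (s := (m : ℝ) / 2 + 1) (by positivity)
      rw [h1, h2, Real.Gamma_add_one (s := ((m : ℝ) + 1) / 2) (by positivity),
        Real.Gamma_add_one (s := (m : ℝ) / 2 + 1)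
        (by positivity)]
      generalize Real.Gamma ((m : ℝ) / 2 + 1) = G at *
      simp only [Real.sin_zero, Real.sin_pi, ne_eq, Nat.add_eq_zero_iff, one_ne_zero, and_false,
        not_false_eq_true, zero_pow, zero_mul, sub_self, zero_div, zero_add]
      field_simp
  exact (key m).1

/-- This holds at the poles of `Γ` too, because `Real.Gamma` vanishes there. -/
theorem inv_Gamma_eq (x : ℝ) : (Real.Gamma x)⁻¹ = x * (Real.Gamma (x + 1))⁻¹ := by
  rcases eq_or_ne x 0 with rfl | hx
  · simp [Real.Gamma_zero]
  · rw [Real.Gamma_add_one hx]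
    field_simp

/-- Proved by recursion on `μ`, integrating the derivative of `sin^(α+1) θ cos ((2μ+1)θ)`. If the
first `Γ` has a pole, both sides are zero. -/
theorem integral_cos_mul_sin_pow (μ α : ℕ) :
    ∫ θ in (0 : ℝ)..Real.pi, Real.cos ((2 * μ : ℕ) * θ) * Real.sin θ ^ α =
      Real.pi * α.factorial / 2 ^ α * ((-1) ^ μ /
        (Real.Gamma ((α : ℝ) / 2 - μ + 1) * Real.Gamma ((α : ℝ) / 2 + μ + 1))) := by
  induction μ with
  | zero =>
    have h := Real.Gamma_mul_Gamma_add_half (((α : ℝ) + 1) / 2)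
    rw [show ((α : ℝ) + 1) / 2 + 1 / 2 = (α : ℝ) / 2 + 1 by ring,
      show 2 * (((α : ℝ) + 1) / 2) = α + 1 by ring, Real.Gamma_nat_eq_factorial,
      show 1 - ((α : ℝ) + 1) = -(α : ℝ) by ring, Real.rpow_neg (by norm_num),
      Real.rpow_natCast] at h
    have h1 := Real.Gamma_pos_of_pos (s := (α : ℝ) / 2 + 1) (by positivity)
    have h2 := Real.mul_self_sqrt Real.pi_pos.le
    simp only [mul_zero, Nat.cast_zero, zero_mul, Real.cos_zero, one_mul, sub_zero, add_zero,
      pow_zero]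
    rw [integral_sin_pow_eq_Gamma]
    field_simp at h ⊢
    linear_combination Real.sqrt Real.pi * h + (α.factorial : ℝ) * h2
  | succ μ ih =>
    have hder : ∀ θ : ℝ, HasDerivAt
        (fun θ => Real.sin θ ^ (α + 1) * Real.cos ((2 * μ + 1 : ℕ) * θ))
        (((α : ℝ) + 2 * μ + 2) / 2 * (Real.cos ((2 * (μ + 1) : ℕ) * θ) * Real.sin θ ^ α) +
          ((α : ℝ) - 2 * μ) / 2 * (Real.cos ((2 * μ : ℕ) * θ) * Real.sin θ ^ α)) θ := by
      intro θ
      have h1 := (Real.hasDerivAt_sin θ).pow (α + 1)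
      have h2 := (Real.hasDerivAt_cos ((2 * μ + 1 : ℕ) * θ)).comp θ
        ((hasDerivAt_id θ).const_mul (((2 * μ + 1 : ℕ) : ℝ)))
      convert! h1.mul h2 using 1
      rw [show ((2 * (μ + 1) : ℕ) : ℝ) * θ = (2 * μ + 1 : ℕ) * θ + θ by push_cast; ring,
        show ((2 * μ : ℕ) : ℝ) * θ = (2 * μ + 1 : ℕ) * θ - θ by push_cast; ring,
        Real.cos_add, Real.cos_sub]
      simp only [Function.comp, Pi.pow_apply, add_tsub_cancel_right]
      push_cast
      ring
    have hint := intervalIntegral.integral_eq_sub_of_hasDerivAt (a := 0) (b := Real.pi)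
      (fun θ _ => hder θ) (Continuous.intervalIntegrable (by fun_prop) _ _)
    rw [intervalIntegral.integral_add (Continuous.intervalIntegrable (by fun_prop) _ _)
      (Continuous.intervalIntegrable (by fun_prop) _ _), intervalIntegral.integral_const_mul,
      intervalIntegral.integral_const_mul, ih] at hint
    simp only [Real.sin_pi, Real.sin_zero, ne_eq, Nat.add_eq_zero_iff, one_ne_zero, and_false,
      not_false_eq_true, zero_pow, zero_mul, sub_self] at hint
    have h1 := inv_Gamma_eq ((α : ℝ) / 2 - μ)
    have h2 : Real.Gamma ((α : ℝ) / 2 + μ + 1 + 1) =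
        ((α : ℝ) / 2 + μ + 1) * Real.Gamma ((α : ℝ) / 2 + μ + 1) :=
      Real.Gamma_add_one (by positivity)
    have h3 := Real.Gamma_pos_of_pos (s := (α : ℝ) / 2 + μ + 1) (by positivity)
    have h4 : (α : ℝ) + 2 * μ + 2 ≠ 0 := by positivity
    have h5 : (α : ℝ) / 2 + μ + 1 ≠ 0 := by positivity
    rw [show (α : ℝ) / 2 - (μ + 1 : ℕ) + 1 = (α : ℝ) / 2 - μ by push_cast; ring,
      show (α : ℝ) / 2 + (μ + 1 : ℕ) + 1 = (α : ℝ) / 2 + μ + 1 + 1 by push_cast; ring, h2,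
      pow_succ]
    generalize Real.Gamma ((α : ℝ) / 2 + μ + 1) = D at *
    rw [div_mul_eq_div_div _ (Real.Gamma ((α : ℝ) / 2 - μ)), div_eq_mul_inv _ (Real.Gamma _), h1]
    rw [div_mul_eq_div_div _ (Real.Gamma ((α : ℝ) / 2 - μ + 1)),
      div_eq_mul_inv _ (Real.Gamma _)] at hint
    generalize (Real.Gamma ((α : ℝ) / 2 - μ + 1))⁻¹ = g at *
    field_simp at hint ⊢
    linear_combination hint

/-- The generalized Clenshaw-Curtis rule is exact on cosines: the weights are cosine sums of the
moments `∫ cos (2μθ) sin^α θ dθ`, from which discrete orthogonality extracts a single one. -/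
theorem sum_quadWeight_mul_cos {α M : ℕ} (hα : 0 < α) (hM : 0 < M) {k : ℕ}
    (hk : k ≤ M) :
    ∑ u ∈ Finset.range (M + 1), quadWeight α M u * Real.cos (k * (u * Real.pi / M)) =
      ∫ θ in (0 : ℝ)..Real.pi, Real.cos (k * θ) * Real.sin θ ^ α := by
  have hM' : (M : ℝ) ≠ 0 := by exact_mod_cast hM.ne'
  set G : ℕ → ℝ := fun μ => (-1) ^ μ /
    (Real.Gamma ((α : ℝ) / 2 - μ + 1) * Real.Gamma ((α : ℝ) / 2 + μ + 1)) with hG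
  have h1 : ∀ u : ℕ, quadWeight α M u * Real.cos (k * (u * Real.pi / M)) =
      ∑ μ ∈ Finset.range (M / 2 + 1), Real.pi * (α.factorial : ℝ) / (2 ^ (α - 1) * (M : ℝ)) *
        (quadEps M (2 * μ) * G μ) * (quadEps M u *
          (Real.cos ((2 * μ : ℕ) * (u * Real.pi / M)) * Real.cos (k * (u * Real.pi / M)))) := by
    intro u
    rw [quadWeight, Finset.mul_sum, Finset.mul_sum, Finset.sum_mul]
    refine Finset.sum_congr rfl fun μ _ => ?_
    rw [hG, show 2 * (μ : ℝ) * (u : ℝ) * Real.pi / (M : ℝ) = (2 * μ : ℕ) * (u * Real.pi / M) by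
      push_cast; ring]
    ring
  simp_rw [h1]
  rw [Finset.sum_comm]
  have h2 : ∀ μ ∈ Finset.range (M / 2 + 1), ∑ u ∈ Finset.range (M + 1),
      Real.pi * (α.factorial : ℝ) / (2 ^ (α - 1) * (M : ℝ)) *
        (quadEps M (2 * μ) * G μ) * (quadEps M u *
          (Real.cos ((2 * μ : ℕ) * (u * Real.pi / M)) * Real.cos (k * (u * Real.pi / M)))) =
      if 2 * μ = k then Real.pi * (α.factorial : ℝ) / 2 ^ α * G μ else 0 := by
    intro μ hμ
    have := Finset.mem_range.1 hμ
    rw [← Finset.mul_sum, sum_quadEps_cos_mul_cos hM (by omega) hk]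
    split_ifs
    · have h3 : quadEps M (2 * μ) ≠ 0 := by
        unfold quadEps
        split_ifs <;> norm_num
      have h4 : (2 : ℝ) ^ α = 2 ^ (α - 1) * 2 := by rw [← pow_succ, Nat.sub_add_cancel hα]
      rw [h4]
      field_simp
    · rw [mul_zero]
  rw [Finset.sum_congr rfl h2]
  rcases Nat.even_or_odd' k with ⟨μ, rfl | rfl⟩
  · rw [Finset.sum_eq_single_of_mem μ (Finset.mem_range.2 (by omega)) fun b _ hb =>
      if_neg (by omega), if_pos rfl, integral_cos_mul_sin_pow]
  · rw [integral_cos_odd_mul_sin_pow ⟨μ, rfl⟩, Finset.sum_eq_zero fun b _ => if_neg (by omega)]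

/-- The trapezoidal rule with end-point corrections, on the half circle. -/
theorem sum_quadEps_mul_cos {M : ℕ} (hM : 0 < M) {k : ℕ} (hk : k < 2 * M) :
    ∑ u ∈ Finset.range (M + 1), (Real.pi / M * quadEps M u) * Real.cos (k * (u * Real.pi / M)) =
      ∫ θ in (0 : ℝ)..Real.pi, Real.cos (k * θ) * 1 := by
  have hM' : (M : ℝ) ≠ 0 := by exact_mod_cast hM.ne'
  have h := sum_quadEps_cos hM k
  simp only [Int.cast_natCast] at h
  simp_rw [mul_assoc]
  rw [← Finset.mul_sum, h]
  simp only [mul_one]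
  rcases Nat.eq_zero_or_pos k with rfl | hk0
  · simp
    field_simp
  · rw [if_neg fun h' => by
      have := Int.le_of_dvd (by omega) h'
      omega]
    rw [intervalIntegral.integral_comp_mul_left _ (by exact_mod_cast hk0.ne')]
    simp [Real.sin_nat_mul_pi]

theorem integral_cos_pow_mul_sin_pow (m : ℕ) (a : ℕ) :
    ∫ θ in (0 : ℝ)..Real.pi, Real.cos θ ^ a * Real.sin θ ^ m =
      gaussMoment a * Real.Gamma (((m : ℝ) + 1) / 2) / Real.Gamma (((a : ℝ) + m + 2) / 2) := by
  induction a using Nat.strong_induction_on with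
  | _ a ih =>
    rcases a with _ | _ | a
    · simp only [pow_zero, one_mul]
      rw [integral_sin_pow_eq_Gamma, gaussMoment, if_pos (by simp), ← Real.Gamma_one_half_eq]
      congr 2 <;> push_cast <;> ring_nf
    · have h := integral_sin_pow_mul_cos_pow_odd (a := 0) (b := Real.pi) m 0
      simp only [mul_zero, zero_add, Real.sin_zero, Real.sin_pi, intervalIntegral.integral_same]
        at h
      simp_rw [mul_comm (Real.cos _ ^ _), zero_add]
      rw [h, gaussMoment_one]
      simp
    · have hder : ∀ θ : ℝ, HasDerivAt
          (fun θ => Real.cos θ ^ (a + 1) * Real.sin θ ^ (m + 1))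
          (((a : ℝ) + m + 2) * (Real.cos θ ^ (a + 2) * Real.sin θ ^ m) -
            ((a : ℝ) + 1) * (Real.cos θ ^ a * Real.sin θ ^ m)) θ := by
        intro θ
        have h1 := (Real.hasDerivAt_cos θ).pow (a + 1)
        have h2 := (Real.hasDerivAt_sin θ).pow (m + 1)
        convert! h1.mul h2 using 1
        simp only [Pi.pow_apply, add_tsub_cancel_right]
        push_cast
        have h3 := Real.sin_sq_add_cos_sq θ
        linear_combination ((a + 1 : ℝ) * Real.cos θ ^ a * Real.sin θ ^ m) * h3
      have hint := intervalIntegral.integral_eq_sub_of_hasDerivAt (a := 0) (b := Real.pi)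
        (fun θ _ => hder θ) (Continuous.intervalIntegrable (by fun_prop) _ _)
      rw [intervalIntegral.integral_sub (Continuous.intervalIntegrable (by fun_prop) _ _)
        (Continuous.intervalIntegrable (by fun_prop) _ _), intervalIntegral.integral_const_mul,
        intervalIntegral.integral_const_mul, ih a (by omega)] at hint
      simp only [Real.sin_pi, Real.sin_zero, ne_eq, Nat.add_eq_zero_iff, one_ne_zero, and_false,
        not_false_eq_true, zero_pow, mul_zero, sub_self] at hint
      have h1 : (((a + 1 + 1 : ℕ) : ℝ) + m + 2) / 2 = ((a : ℝ) + m + 2) / 2 + 1 := by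
        push_cast; ring
      have h2 := Real.Gamma_pos_of_pos (s := ((a : ℝ) + m + 2) / 2) (by positivity)
      have h3 : (a : ℝ) + m + 2 ≠ 0 := by positivity
      rw [h1, Real.Gamma_add_one (by positivity), gaussMoment_add_two]
      field_simp at hint ⊢
      linear_combination hint

/-- The generalized Clenshaw-Curtis rule on `cos^a sin^b`. -/
theorem sum_quadWeight_mul_cos_pow_mul_sin_pow {α M : ℕ} (hα : 0 < α) (hM : 0 < M)
    {a b : ℕ} (hb : Even b) (hab : a + b ≤ M) :
    ∑ u ∈ Finset.range (M + 1), quadWeight α M u *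
        (Real.cos (u * Real.pi / M) ^ a * Real.sin (u * Real.pi / M) ^ b) =
      gaussMoment a * Real.Gamma (((b + α : ℕ) + 1) / 2) /
        Real.Gamma (((a : ℝ) + (b + α : ℕ) + 2) / 2) := by
  obtain ⟨c, rfl⟩ := hb
  rw [← integral_cos_pow_mul_sin_pow, ← two_mul]
  rw [quadrature_of_cos (N := M) (w := fun θ => Real.sin θ ^ α) (by fun_prop)
    (fun k hk => sum_quadWeight_mul_cos hα hM hk)
    (cosSpan_mono (by omega) (cos_pow_mul_sin_pow_mem_cosSpan a c))]
  simp only [mul_assoc, ← pow_add]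

/-- The trapezoidal rule on the circle, for `cos^a sin^b`. -/
theorem sum_circle_cos_pow_mul_sin_pow {M : ℕ} (hM : 0 < M) {a b : ℕ} (hab : a + b < 2 * M) :
    ∑ t ∈ Finset.range (2 * M), Real.pi / M *
        (Real.cos (t * Real.pi / M) ^ a * Real.sin (t * Real.pi / M) ^ b) =
      2 * (gaussMoment a * gaussMoment b / Real.Gamma (((a : ℝ) + b + 2) / 2)) := by
  have hM' : (M : ℝ) ≠ 0 := by exact_mod_cast hM.ne'
  have hrefl : ∀ t ≤ 2 * M, ((2 * M - t : ℕ) : ℝ) * Real.pi / M =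
      2 * Real.pi - t * Real.pi / M := by
    intro t ht
    rw [Nat.cast_sub ht]
    push_cast
    field_simp
  have hc : ∀ t ≤ 2 * M, Real.cos ((2 * M - t : ℕ) * Real.pi / M) = Real.cos (t * Real.pi / M) :=
    fun t ht => by rw [hrefl t ht, Real.cos_two_pi_sub]
  have hs : ∀ t ≤ 2 * M, Real.sin ((2 * M - t : ℕ) * Real.pi / M) =
      -Real.sin (t * Real.pi / M) := fun t ht => by rw [hrefl t ht, Real.sin_two_pi_sub]
  rcases Nat.even_or_odd b with hb | hb
  · rw [sum_range_eq_two_mul_sum_quadEps hM]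
    · have h : gaussMoment b = Real.Gamma (((b : ℝ) + 1) / 2) := if_pos hb
      obtain ⟨c, rfl⟩ := hb
      rw [← two_mul] at *
      have h1 := quadrature_of_cos (N := a + 2 * c) (M := M)
        (χ := fun u => Real.pi / M * quadEps M u) (w := fun _ => 1) continuous_const
        (fun k hk => sum_quadEps_mul_cos hM (by omega)) (cos_pow_mul_sin_pow_mem_cosSpan a c)
      simp only [mul_one] at h1
      rw [h, ← integral_cos_pow_mul_sin_pow, ← h1]
      congr 1
      exact Finset.sum_congr rfl fun u _ => by ring
    · intro t _ ht
      rw [hc t (by omega), hs t (by omega), hb.neg_pow]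
  · rw [show gaussMoment b = 0 from if_neg (Nat.not_even_iff_odd.2 hb)]
    simp only [mul_zero, zero_div]
    rw [← Finset.mul_sum]
    refine mul_eq_zero_of_right _ ?_
    obtain ⟨K, hK⟩ : ∃ K, 2 * M = K + 1 := ⟨2 * M - 1, by omega⟩
    rw [hK, Finset.sum_range_succ']
    have h0 : Real.sin (((0 : ℕ) : ℝ) * Real.pi / M) ^ b = 0 := by
      simp [hb.pos.ne']
    rw [h0, mul_zero, add_zero]
    have h1 := Finset.sum_range_reflect (fun t : ℕ =>
      Real.cos ((t + 1 : ℕ) * Real.pi / M) ^ a * Real.sin ((t + 1 : ℕ) * Real.pi / M) ^ b) K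
    have h2 : ∑ t ∈ Finset.range K, Real.cos ((K - 1 - t + 1 : ℕ) * Real.pi / M) ^ a *
          Real.sin ((K - 1 - t + 1 : ℕ) * Real.pi / M) ^ b =
        -∑ t ∈ Finset.range K, Real.cos ((t + 1 : ℕ) * Real.pi / M) ^ a *
          Real.sin ((t + 1 : ℕ) * Real.pi / M) ^ b := by
      rw [← Finset.sum_neg_distrib]
      refine Finset.sum_congr rfl fun t ht => ?_
      have := Finset.mem_range.1 ht
      rw [show K - 1 - t + 1 = 2 * M - (t + 1) by omega, hc _ (by omega), hs _ (by omega),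
        hb.neg_pow]
      ring
    linarith

end

section

open MvPolynomial

variable {n : ℕ}

/-! ### Product quadrature on the sphere -/

/-- The degree `∑_{i ≤ m ≤ n} a m` of a monomial in the coordinates from `i` on. -/
def tailDegree (n : ℕ) (a : ℕ → ℕ) (i : ℕ) : ℕ := ∑ m ∈ Finset.Ico i (n + 1), a m

theorem tailDegree_eq_add (a : ℕ → ℕ) {i : ℕ} (hi : i ≤ n) :
    tailDegree n a i = a i + tailDegree n a (i + 1) :=
  Finset.sum_eq_sum_Ico_succ_bot (by omega) _

theorem tailDegree_last (a : ℕ → ℕ) : tailDegree n a n = a n := by simp [tailDegree]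

/-- In spherical coordinates monomials separate. -/
theorem prod_sphCoord_pow (a : ℕ → ℕ) (θ : ℕ → ℝ) :
    ∏ i ∈ Finset.range (n + 1), sphCoord n θ i ^ a i =
      ∏ i ∈ Finset.range n, Real.cos (θ i) ^ a i * Real.sin (θ i) ^ tailDegree n a (i + 1) := by
  have key : ∀ r ≤ n, (∏ i ∈ Finset.range r, sphCoord n θ i ^ a i) *
      (∏ m ∈ Finset.range r, Real.sin (θ m)) ^ tailDegree n a r =
      ∏ i ∈ Finset.range r, Real.cos (θ i) ^ a i * Real.sin (θ i) ^ tailDegree n a (i + 1) := by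
    intro r
    induction r with
    | zero => simp
    | succ r ih =>
      intro hr
      rw [Finset.prod_range_succ _ r, Finset.prod_range_succ _ r, Finset.prod_range_succ _ r,
        ← ih (by omega), tailDegree_eq_add a (by omega : r ≤ n), sphCoord,
        if_pos (by omega : r < n)]
      ring
  rw [← key n le_rfl, Finset.prod_range_succ, tailDegree_last, sphCoord, if_neg (lt_irrefl n),
    mul_one]

/-- The product over the polar angles of the beta integrals telescopes. -/
theorem prod_beta_telescope (a : ℕ → ℕ) {r : ℕ} (hr : r ≤ n) :
    (∏ i ∈ Finset.range r, gaussMoment (a i) *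
        Real.Gamma (((tailDegree n a (i + 1) + (n - 1 - i) : ℕ) + 1) / 2) /
        Real.Gamma (((a i : ℝ) + (tailDegree n a (i + 1) + (n - 1 - i) : ℕ) + 2) / 2)) =
      (∏ i ∈ Finset.range r, gaussMoment (a i)) *
        (Real.Gamma (((tailDegree n a r : ℝ) + (n - r) + 1) / 2) /
          Real.Gamma (((tailDegree n a 0 : ℝ) + n + 1) / 2)) := by
  induction r with
  | zero =>
    have := Real.Gamma_pos_of_pos (s := ((tailDegree n a 0 : ℝ) + n + 1) / 2) (by positivity)
    simp
    field_simp
  | succ r ih =>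
    rw [Finset.prod_range_succ, ih (by omega), Finset.prod_range_succ]
    have h1 : (((n - 1 - r : ℕ)) : ℝ) = n - r - 1 := by
      rw [Nat.sub_sub, Nat.cast_sub (by omega)]
      push_cast
      ring
    have h2 : ((a r : ℝ) + (tailDegree n a (r + 1) + (n - 1 - r) : ℕ) + 2) / 2 =
        ((tailDegree n a r : ℝ) + (n - r) + 1) / 2 := by
      rw [tailDegree_eq_add a (by omega : r ≤ n)]
      push_cast
      rw [h1]
      ring
    have h3 : (((tailDegree n a (r + 1) + (n - 1 - r) : ℕ) : ℝ) + 1) / 2 =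
        ((tailDegree n a (r + 1) : ℝ) + (n - (r + 1 : ℕ)) + 1) / 2 := by
      push_cast
      rw [h1]
      ring
    have hr' : (r : ℝ) ≤ n := by exact_mod_cast (by omega : r ≤ n)
    have hpos : (0 : ℝ) < ((tailDegree n a r : ℝ) + (n - r) + 1) / 2 := by
      have : (0 : ℝ) ≤ tailDegree n a r := Nat.cast_nonneg _
      linarith
    have h4 := Real.Gamma_pos_of_pos hpos
    rw [h2, h3]
    field_simp

/-- The one-dimensional quadrature sums which make up the sum over the nodes. -/
theorem sum_nodes_eq_prod (hn : 2 ≤ n) (j : ℕ) (a : ℕ → ℕ) :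
    ∑ q : NodeIndex n j, nodeWeight n j q * (Real.pi / 2 ^ j * ∏ i, (node n j q).1 i ^ a i) =
      (∏ i ∈ Finset.range (n - 1), ∑ u ∈ Finset.range (2 ^ j + 1),
        quadWeight (n - 1 - i) (2 ^ j) u * (Real.cos (u * Real.pi / (2 ^ j : ℕ)) ^ a i *
          Real.sin (u * Real.pi / (2 ^ j : ℕ)) ^ tailDegree n a (i + 1))) *
      ∑ t ∈ Finset.range (2 * 2 ^ j), Real.pi / (2 ^ j : ℕ) *
        (Real.cos (t * Real.pi / (2 ^ j : ℕ)) ^ a (n - 1) *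
          Real.sin (t * Real.pi / (2 ^ j : ℕ)) ^ a n) := by
  have hn1 : n - 1 + 1 = n := by omega
  have hnode : ∀ q : NodeIndex n j, ∏ i, (node n j q).1 i ^ a i =
      (∏ i : Fin (n - 1), Real.cos ((q.1 i : ℕ) * Real.pi / (2 ^ j : ℕ)) ^ a i *
          Real.sin ((q.1 i : ℕ) * Real.pi / (2 ^ j : ℕ)) ^ tailDegree n a (i + 1)) *
        (Real.cos ((q.2 : ℕ) * Real.pi / (2 ^ j : ℕ)) ^ a (n - 1) *
          Real.sin ((q.2 : ℕ) * Real.pi / (2 ^ j : ℕ)) ^ a n) := by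
    intro q
    set θ : ℕ → ℝ := fun i => if h : i < n - 1 then ((q.1 ⟨i, h⟩ : ℕ) : ℝ) * Real.pi / 2 ^ j
      else ((q.2 : ℕ) : ℝ) * Real.pi / 2 ^ j with hθ
    have h1 : ∏ i, (node n j q).1 i ^ a i = ∏ i ∈ Finset.range (n + 1), sphCoord n θ i ^ a i := by
      rw [Finset.prod_range]
      rfl
    have h2 : ∀ g : ℕ → ℝ, ∏ i ∈ Finset.range n, g i =
        (∏ i ∈ Finset.range (n - 1), g i) * g (n - 1) := fun g => by
      rw [← Finset.prod_range_succ, hn1]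
    rw [h1, prod_sphCoord_pow, h2, hn1, tailDegree_last, Finset.prod_range]
    congr 1
    · refine Finset.prod_congr rfl fun i _ => ?_
      simp [hθ]
    · simp [hθ]
  rw [Fintype.sum_prod_type_right]
  have hsplit : ∀ (t : Fin (2 ^ (j + 1))) (s : Fin (n - 1) → Fin (2 ^ j + 1)),
      nodeWeight n j (s, t) * (Real.pi / 2 ^ j * ∏ i, (node n j (s, t)).1 i ^ a i) =
      (∏ i : Fin (n - 1), quadWeight (n - 1 - (i : ℕ)) (2 ^ j) (s i : ℕ) *
        (Real.cos ((s i : ℕ) * Real.pi / (2 ^ j : ℕ)) ^ a i *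
          Real.sin ((s i : ℕ) * Real.pi / (2 ^ j : ℕ)) ^ tailDegree n a (i + 1))) *
      (Real.pi / (2 ^ j : ℕ) * (Real.cos ((t : ℕ) * Real.pi / (2 ^ j : ℕ)) ^ a (n - 1) *
          Real.sin ((t : ℕ) * Real.pi / (2 ^ j : ℕ)) ^ a n)) := by
    intro t s
    rw [hnode, nodeWeight, Finset.prod_mul_distrib (f := fun i : Fin (n - 1) =>
      quadWeight (n - 1 - (i : ℕ)) (2 ^ j) (s i : ℕ))]
    push_cast
    ring
  simp_rw [hsplit, ← Finset.sum_mul]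
  rw [← Finset.mul_sum]
  congr 1
  · simp_rw [Finset.prod_range, Finset.sum_range]
    rw [Finset.prod_univ_sum, Fintype.piFinset_univ]
  · rw [← pow_succ', Finset.sum_range]

/-- The nodes and weights integrate all polynomials of degree at most `2^j` exactly: for monomials,
both sides are products of beta integrals, and they vanish if some exponent is odd. -/
theorem sum_nodes_monomial (hn : 2 ≤ n) (j : ℕ) (a : ℕ → ℕ)
    (ha : tailDegree n a 0 ≤ 2 ^ j) :
    ∑ q : NodeIndex n j, nodeWeight n j q * (Real.pi / 2 ^ j * ∏ i, (node n j q).1 i ^ a i) =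
      2 / Real.Gamma (((tailDegree n a 0 : ℝ) + n + 1) / 2) *
        ∏ i ∈ Finset.range (n + 1), gaussMoment (a i) := by
  have hn1 : n - 1 + 1 = n := by omega
  have hM : 0 < 2 ^ j := by positivity
  have hle : ∀ i ≤ n, tailDegree n a i ≤ tailDegree n a 0 := fun i _ =>
    Finset.sum_le_sum_of_subset (Finset.Ico_subset_Ico_left (Nat.zero_le i))
  have hQ : ∀ i < n - 1, Even (tailDegree n a (i + 1)) → ∑ u ∈ Finset.range (2 ^ j + 1),
        quadWeight (n - 1 - i) (2 ^ j) u * (Real.cos (u * Real.pi / (2 ^ j : ℕ)) ^ a i *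
          Real.sin (u * Real.pi / (2 ^ j : ℕ)) ^ tailDegree n a (i + 1)) =
      gaussMoment (a i) *
        Real.Gamma (((tailDegree n a (i + 1) + (n - 1 - i) : ℕ) + 1) / 2) /
        Real.Gamma (((a i : ℝ) + (tailDegree n a (i + 1) + (n - 1 - i) : ℕ) + 2) / 2) := by
    intro i hi he
    have h1 := hle i (by omega)
    rw [tailDegree_eq_add a (by omega : i ≤ n)] at h1
    exact sum_quadWeight_mul_cos_pow_mul_sin_pow (by omega) hM he (by omega)
  have hT := sum_circle_cos_pow_mul_sin_pow hM (a := a (n - 1)) (b := a n) (by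
    have h1 := hle (n - 1) (by omega)
    rw [tailDegree_eq_add a (by omega : n - 1 ≤ n), hn1, tailDegree_last] at h1
    omega)
  rw [sum_nodes_eq_prod hn, hT]
  by_cases hall : ∀ i ≤ n, Even (a i)
  · have heven : ∀ i, Even (tailDegree n a i) := fun i => Finset.even_sum _ fun m hm =>
      hall m (by have := (Finset.mem_Ico.1 hm).2; omega)
    rw [Finset.prod_congr rfl fun i hi => hQ i (Finset.mem_range.1 hi) (heven _),
      prod_beta_telescope a (by omega), Finset.prod_range_succ]
    conv_rhs => rw [← hn1, Finset.prod_range_succ, hn1]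
    rw [tailDegree_eq_add a (by omega : n - 1 ≤ n), hn1, tailDegree_last]
    have h1 : ((a (n - 1) + a n : ℕ) + ((n : ℝ) - (n - 1 : ℕ)) + 1) / 2 =
        ((a (n - 1) : ℝ) + a n + 2) / 2 := by
      rw [Nat.cast_sub (by omega)]
      push_cast
      ring
    have h2 := Real.Gamma_pos_of_pos (s := ((a (n - 1) : ℝ) + a n + 2) / 2) (by positivity)
    rw [h1]
    field_simp
  · -- The last odd exponent makes its quadrature sum vanish.
    push Not at hall
    obtain ⟨m, hm, hmax⟩ : ∃ m, (m ≤ n ∧ ¬ Even (a m)) ∧ ∀ i ≤ n, m < i → Even (a i) := by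
      classical
      obtain ⟨m₀, hm₀⟩ := hall
      have hne : ((Finset.range (n + 1)).filter fun m => ¬ Even (a m)).Nonempty :=
        ⟨m₀, Finset.mem_filter.2 ⟨Finset.mem_range.2 (by omega), hm₀.2⟩⟩
      refine ⟨Finset.max' _ hne, ?_, ?_⟩
      · have := Finset.mem_filter.1 (Finset.max'_mem _ hne)
        exact ⟨by have := Finset.mem_range.1 this.1; omega, this.2⟩
      · intro i hi hlt
        by_contra hodd
        exact absurd (Finset.le_max' _ i (Finset.mem_filter.2 ⟨Finset.mem_range.2 (by omega), hodd⟩))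
          (not_le.2 hlt)
    have hg : gaussMoment (a m) = 0 := if_neg hm.2
    rw [Finset.prod_eq_zero (Finset.mem_range.2 (by omega : m < n + 1)) hg, mul_zero]
    by_cases hmn : m < n - 1
    · refine mul_eq_zero_of_left (Finset.prod_eq_zero (Finset.mem_range.2 hmn) ?_) _
      rw [hQ m hmn (Finset.even_sum _ fun i hi => by
        have := Finset.mem_Ico.1 hi
        exact hmax i (by omega) (by omega)), hg, zero_mul, zero_div]
    · rcases (by omega : m = n - 1 ∨ m = n) with rfl | rfl <;> simp [hg]

/-- Exactness of the quadrature on the sphere for polynomials of degree at most `2^j`. -/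
theorem sum_nodes_restrictSphere (hn : 2 ≤ n) {j : ℕ}
    {p : MvPolynomial (Fin (n + 1)) ℂ} (hp : p.totalDegree ≤ 2 ^ j) :
    ∑ q : NodeIndex n j, (nodeWeight n j q : ℂ) * ((Real.pi / 2 ^ j : ℝ) *
      restrictSphere n p (node n j q)) = ∫ x, restrictSphere n p x ∂(sigma n) := by
  have hs : ∀ x, restrictSphere n p x =
      ∑ b ∈ p.support, restrictSphere n (monomial b (coeff b p)) x := by
    intro x
    conv_lhs => rw [p.as_sum, map_sum]
    exact Finset.sum_apply _ _ _
  simp_rw [hs]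
  rw [integral_finsetSum _ fun b _ => integrable_restrictSphere n _]
  simp_rw [Finset.mul_sum]
  rw [Finset.sum_comm]
  refine Finset.sum_congr rfl fun b hb => ?_
  rw [integral_restrictSphere_monomial]
  set a : ℕ → ℕ := fun i => if h : i < n + 1 then b ⟨i, h⟩ else 0 with hadef
  have hab : ∀ i : Fin (n + 1), b i = a i := fun i => by
    simp only [hadef, dif_pos i.2, Fin.eta]
  have htd : tailDegree n a 0 = ∑ i, b i := by
    rw [tailDegree, ← Finset.range_eq_Ico, Finset.sum_range]
    exact Finset.sum_congr rfl fun i _ => (hab i).symm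
  have hdeg : tailDegree n a 0 ≤ 2 ^ j := by
    rw [htd]
    refine le_trans ?_ hp
    have := le_totalDegree hb
    rwa [Finsupp.sum_fintype _ _ (by simp)] at this
  have h1 := congrArg (fun x : ℝ => (x : ℂ)) (sum_nodes_monomial hn j a hdeg)
  rw [htd, Finset.prod_range] at h1
  have h2 : ∀ q, restrictSphere n (monomial b (coeff b p)) (node n j q) =
      coeff b p * ((∏ i, (node n j q).1 i ^ a i : ℝ) : ℂ) := by
    intro q
    rw [restrictSphere_apply, eval_monomial, Finsupp.prod_fintype _ _ (by simp)]
    simp [hab]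
  simp_rw [h2, hab] at h1 ⊢
  push_cast at h1 ⊢
  rw [← h1, Finset.mul_sum]
  exact Finset.sum_congr rfl fun q _ => by ring

end

section

variable {n : ℕ}

/-! ### Values of Gegenbauer polynomials at one -/

theorem gegenbauer_eq_sum_of_lt (μ : ℝ) {l K : ℕ} (hK : l / 2 < K) (t : ℝ) :
    gegenbauer μ l t = ∑ k ∈ Finset.range K,
      if 2 * k ≤ l then gegenbauerCoeff μ l k * (2 * t) ^ (l - 2 * k) else 0 := by
  rw [gegenbauer_eq_sum, ← Finset.sum_filter]
  refine Finset.sum_congr ?_ fun _ _ => rfl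
  ext k
  simp only [Finset.mem_range, Finset.mem_filter]
  omega

/-- The three-term recurrence of the Gegenbauer polynomials. -/
theorem gegenbauer_recurrence (μ : ℝ) (l : ℕ) (t : ℝ) :
    ((l : ℝ) + 2) * gegenbauer μ (l + 2) t =
      2 * (l + 1 + μ) * t * gegenbauer μ (l + 1) t - (l + 2 * μ) * gegenbauer μ l t := by
  rw [gegenbauer_eq_sum_of_lt μ (by omega : (l + 2) / 2 < l + 1 + 1),
    gegenbauer_eq_sum_of_lt μ (by omega : (l + 1) / 2 < l + 1 + 1),
    gegenbauer_eq_sum_of_lt μ (by omega : l / 2 < l + 1),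
    Finset.sum_range_succ' _ (l + 1), Finset.sum_range_succ' _ (l + 1), mul_add, mul_add,
    add_sub_right_comm]
  congr 1
  · rw [Finset.mul_sum, Finset.mul_sum, Finset.mul_sum, ← Finset.sum_sub_distrib]
    refine Finset.sum_congr rfl fun k _ => ?_
    by_cases h : 2 * k ≤ l
    · obtain ⟨a, rfl⟩ := Nat.exists_eq_add_of_le h
      rw [if_pos (by omega), if_pos h]
      have hk : (k.factorial : ℝ) ≠ 0 := by positivity
      rcases a with _ | a
      · rw [if_neg (by omega)]
        simp only [gegenbauerCoeff, show 2 * k + 0 + 2 - (k + 1) = k + 1 by omega,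
          show 2 * k + 0 + 2 - 2 * (k + 1) = 0 by omega, show 2 * k + 0 - k = k by omega,
          show 2 * k + 0 - 2 * k = 0 by omega, ascPochhammer_succ_eval, Nat.factorial_succ,
          pow_succ, Nat.factorial_zero]
        push_cast
        field_simp
        ring
      · rw [if_pos (by omega)]
        have ha : (a.factorial : ℝ) ≠ 0 := by positivity
        simp only [gegenbauerCoeff, show 2 * k + (a + 1) + 2 - (k + 1) = k + a + 1 + 1 by omega,
          show 2 * k + (a + 1) + 2 - 2 * (k + 1) = a + 1 by omega,
          show 2 * k + (a + 1) + 1 - (k + 1) = k + a + 1 by omega,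
          show 2 * k + (a + 1) + 1 - 2 * (k + 1) = a by omega,
          show 2 * k + (a + 1) - k = k + a + 1 by omega,
          show 2 * k + (a + 1) - 2 * k = a + 1 by omega, ascPochhammer_succ_eval,
          Nat.factorial_succ, pow_succ]
        push_cast
        field_simp
        ring
    · rw [if_neg h, if_neg (by omega), if_neg (by omega)]
      ring
  · simp only [mul_zero, Nat.zero_le, if_true, gegenbauerCoeff, Nat.sub_zero,
      ascPochhammer_succ_eval, Nat.factorial_succ, pow_succ]
    have hl : (l.factorial : ℝ) ≠ 0 := by positivity
    push_cast
    field_simp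
    ring

theorem gegenbauer_one (μ : ℝ) (l : ℕ) :
    gegenbauer μ l 1 = (ascPochhammer ℝ l).eval (2 * μ) / l.factorial := by
  induction l using Nat.strong_induction_on with
  | _ l ih =>
    rcases l with _ | _ | l
    · simp [gegenbauer]
    · simp [gegenbauer]
      ring
    · have h := gegenbauer_recurrence μ l 1
      rw [ih l (by omega), ih (l + 1) (by omega)] at h
      have hl : (l.factorial : ℝ) ≠ 0 := by positivity
      have h2 : (l : ℝ) + 2 ≠ 0 := by positivity
      refine mul_left_cancel₀ h2 ?_
      rw [h]
      simp only [ascPochhammer_succ_eval, Nat.factorial_succ]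
      push_cast
      field_simp
      ring

theorem ascPochhammer_eval_mul_factorial (m l : ℕ) :
    (ascPochhammer ℝ l).eval ((m : ℝ) + 1) * m.factorial = (m + l).factorial := by
  induction l with
  | zero => simp
  | succ l ih =>
    rw [ascPochhammer_succ_eval, mul_right_comm, ih, ← add_assoc, Nat.factorial_succ]
    push_cast
    ring

/-- The dimension of the space of spherical polynomials of degree at most `N`, as the value of the
reproducing kernel on the diagonal. -/
theorem sum_gegenbauer_one (hn : 2 ≤ n) (N : ℕ) :
    ∑ l ∈ Finset.range (N + 1), ((l : ℝ) + lam n) / lam n * gegenbauer (lam n) l 1 =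
      ((n + 2 * N : ℕ) : ℝ) * ((n + N - 1).factorial : ℝ) /
        ((n.factorial : ℝ) * (N.factorial : ℝ)) := by
  obtain ⟨m, rfl⟩ : ∃ m, n = m + 2 := ⟨n - 2, by omega⟩
  have hm : (m.factorial : ℝ) ≠ 0 := by positivity
  have hlam : lam (m + 2) = ((m : ℝ) + 1) / 2 := by unfold lam; push_cast; ring
  have hval : ∀ l, gegenbauer (lam (m + 2)) l 1 =
      (m + l).factorial / (m.factorial * l.factorial) := by
    intro l
    rw [gegenbauer_one, hlam, mul_div_cancel₀ _ two_ne_zero, ← ascPochhammer_eval_mul_factorial]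
    field_simp
  simp_rw [hval, hlam]
  induction N with
  | zero =>
    simp [Nat.factorial_succ]
    field_simp
    ring
  | succ N ih =>
    rw [Finset.sum_range_succ, ih]
    have hN : (N.factorial : ℝ) ≠ 0 := by positivity
    rw [show m + 2 + N - 1 = (m + N) + 1 by omega, show m + 2 + (N + 1) - 1 = (m + N) + 1 + 1 by
      omega, show m + (N + 1) = (m + N) + 1 by omega]
    simp only [Nat.factorial_succ]
    push_cast
    field_simp
    ring

theorem scalingKernel_one (hn : 2 ≤ n) {j : ℕ} (hj : 1 ≤ j) :
    scalingKernel n j 1 = (Real.sqrt 2 ^ (n * j))⁻¹ *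
      (((n + 2 ^ j - 2 : ℕ) : ℝ) * ((n + 2 ^ (j - 1) - 2).factorial : ℝ) /
          ((n.factorial : ℝ) * ((2 ^ (j - 1) - 1).factorial : ℝ))) := by
  have h1 : 2 ^ j = 2 * 2 ^ (j - 1) := by rw [← pow_succ', Nat.sub_add_cancel hj]
  have h2 : 2 ^ (j - 1) = (2 ^ (j - 1) - 1) + 1 := by
    have : 0 < 2 ^ (j - 1) := by positivity
    omega
  rw [scalingKernel, h1]
  generalize 2 ^ (j - 1) - 1 = N at *
  rw [h2, sum_gegenbauer_one hn]
  congr 5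

theorem scalingKernel_one_pos (hn : 2 ≤ n) {j : ℕ} (hj : 1 ≤ j) : 0 < scalingKernel n j 1 := by
  rw [scalingKernel_one hn hj]
  have h1 : 2 ≤ 2 ^ j := by
    calc 2 = 2 ^ 1 := rfl
      _ ≤ 2 ^ j := Nat.pow_le_pow_right (by norm_num) hj
  have h2 : (0 : ℝ) < ((n + 2 ^ j - 2 : ℕ) : ℝ) := by exact_mod_cast (by omega)
  positivity

/-! ### Non-negative weights in low dimensions -/

theorem quadEps_mem (M u : ℕ) : 0 ≤ quadEps M u ∧ quadEps M u ≤ 1 := by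
  unfold quadEps
  split_ifs <;> norm_num

theorem neg_one_pow_div_Gamma (μ : ℕ) :
    (-1) ^ μ / (Real.Gamma (((1 : ℕ) : ℝ) / 2 - μ + 1) * Real.Gamma (((1 : ℕ) : ℝ) / 2 + μ + 1)) =
      4 / Real.pi / (1 - 4 * (μ : ℝ) ^ 2) := by
  have hne : ∀ μ : ℕ, (1 : ℝ) - 4 * (μ : ℝ) ^ 2 ≠ 0 := by
    intro μ h
    have : (1 : ℤ) = 4 * (μ : ℤ) ^ 2 := by
      have h' : (1 : ℝ) = 4 * (μ : ℝ) ^ 2 := by linarith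
      exact_mod_cast h'
    omega
  have hpi := Real.pi_pos
  induction μ with
  | zero =>
    have h1 : Real.Gamma (1 / 2 + 1) = Real.sqrt Real.pi / 2 := by
      rw [Real.Gamma_add_one (by norm_num), Real.Gamma_one_half_eq]
      ring
    have h2 := Real.mul_self_sqrt hpi.le
    simp only [pow_zero, Nat.cast_one, Nat.cast_zero, sub_zero, add_zero, h1]
    rw [show Real.sqrt Real.pi / 2 * (Real.sqrt Real.pi / 2) = Real.pi / 4 by linarith]
    norm_num
  | succ μ ih =>
    have h1 := inv_Gamma_eq (((1 : ℕ) : ℝ) / 2 - μ)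
    have h2 : Real.Gamma (((1 : ℕ) : ℝ) / 2 + μ + 1 + 1) =
        (((1 : ℕ) : ℝ) / 2 + μ + 1) * Real.Gamma (((1 : ℕ) : ℝ) / 2 + μ + 1) :=
      Real.Gamma_add_one (by positivity)
    have h3 := hne μ
    have h4 := hne (μ + 1)
    have h5 := Real.Gamma_pos_of_pos (s := ((1 : ℕ) : ℝ) / 2 + μ + 1) (by positivity)
    rw [show ((1 : ℕ) : ℝ) / 2 - (μ + 1 : ℕ) + 1 = ((1 : ℕ) : ℝ) / 2 - μ by push_cast; ring,
      show ((1 : ℕ) : ℝ) / 2 + (μ + 1 : ℕ) + 1 = ((1 : ℕ) : ℝ) / 2 + μ + 1 + 1 by push_cast; ring,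
      h2, pow_succ, div_mul_eq_div_div _ (Real.Gamma _), div_eq_mul_inv _ (Real.Gamma _), h1]
    rw [div_mul_eq_div_div _ (Real.Gamma _),
      div_eq_mul_inv _ (Real.Gamma (((1 : ℕ) : ℝ) / 2 - μ + 1))] at ih
    generalize (Real.Gamma (((1 : ℕ) : ℝ) / 2 - μ + 1))⁻¹ = g at *
    generalize Real.Gamma (((1 : ℕ) : ℝ) / 2 + μ + 1) = D at *
    push_cast at h4 ⊢
    field_simp at ih ⊢
    have h6 : (2 : ℝ) * μ + 1 ≠ 0 := by positivity
    refine mul_left_cancel₀ h6 ?_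
    linear_combination (2 * (μ : ℝ) + 1) * (2 * μ + 3) * ih

theorem quadWeight_one_nonneg (M u : ℕ) : 0 ≤ quadWeight 1 M u := by
  have hpi := Real.pi_pos
  refine mul_nonneg (quadEps_mem M u).1 (mul_nonneg (by positivity) ?_)
  have hterm : ∀ μ : ℕ, quadEps M (2 * μ) * (-1) ^ μ *
        Real.cos (2 * (μ : ℝ) * (u : ℝ) * Real.pi / (M : ℝ)) /
        (Real.Gamma (((1 : ℕ) : ℝ) / 2 - (μ : ℝ) + 1) * Real.Gamma (((1 : ℕ) : ℝ) / 2 + (μ : ℝ) + 1))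
      = quadEps M (2 * μ) * Real.cos (2 * (μ : ℝ) * (u : ℝ) * Real.pi / (M : ℝ)) *
        (4 / Real.pi / (1 - 4 * (μ : ℝ) ^ 2)) := by
    intro μ
    rw [← neg_one_pow_div_Gamma]
    ring
  simp_rw [hterm]
  rw [Finset.sum_range_succ']
  -- The terms with `μ ≥ 1` are bounded by a telescoping sum.
  have hbound : ∀ K : ℕ, -(2 / Real.pi) * (1 - 1 / (2 * K + 1)) ≤
      ∑ μ ∈ Finset.range K, quadEps M (2 * (μ + 1)) *
        Real.cos (2 * ((μ + 1 : ℕ) : ℝ) * (u : ℝ) * Real.pi / (M : ℝ)) *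
        (4 / Real.pi / (1 - 4 * ((μ + 1 : ℕ) : ℝ) ^ 2)) := by
    intro K
    induction K with
    | zero => simp
    | succ K ih =>
      rw [Finset.sum_range_succ]
      have h1 : |quadEps M (2 * (K + 1)) *
          Real.cos (2 * ((K + 1 : ℕ) : ℝ) * (u : ℝ) * Real.pi / (M : ℝ))| ≤ 1 := by
        rw [abs_mul, abs_of_nonneg (quadEps_mem M _).1]
        exact mul_le_one₀ (quadEps_mem M _).2 (abs_nonneg _) (Real.abs_cos_le_one _)
      generalize quadEps M (2 * (K + 1)) *
          Real.cos (2 * ((K + 1 : ℕ) : ℝ) * (u : ℝ) * Real.pi / (M : ℝ)) = c at *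
      have h2 : 4 / Real.pi / (1 - 4 * ((K + 1 : ℕ) : ℝ) ^ 2) =
          -(2 / Real.pi * (1 / (2 * K + 1) - 1 / (2 * (K + 1 : ℕ) + 1))) := by
        rw [show (1 : ℝ) - 4 * ((K + 1 : ℕ) : ℝ) ^ 2 = -((2 * K + 1) * (2 * K + 3)) by
          push_cast; ring]
        push_cast
        field_simp
        ring
      have h3 : (0 : ℝ) ≤ 2 / Real.pi * (1 / (2 * K + 1) - 1 / (2 * (K + 1 : ℕ) + 1)) := by
        refine mul_nonneg (by positivity) (sub_nonneg.2 ?_)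
        refine one_div_le_one_div_of_le (by positivity) ?_
        push_cast
        linarith
      rw [h2]
      have h4 := mul_le_mul_of_nonneg_right (abs_le.1 h1).2 h3
      linarith
  have h0 := hbound (M / 2)
  have h1 : quadEps M (2 * 0) * Real.cos (2 * ((0 : ℕ) : ℝ) * (u : ℝ) * Real.pi / (M : ℝ)) *
        (4 / Real.pi / (1 - 4 * ((0 : ℕ) : ℝ) ^ 2)) = 2 / Real.pi := by
    simp [quadEps]
    ring
  have h2 : 0 ≤ 2 / Real.pi * (1 / (2 * (M / 2 : ℕ) + 1)) := by positivity
  rw [h1]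
  linarith

theorem quadWeight_two_nonneg {M : ℕ} (hM : 2 ≤ M) (u : ℕ) : 0 ≤ quadWeight 2 M u := by
  have hpi := Real.pi_pos
  refine mul_nonneg (quadEps_mem M u).1 (mul_nonneg (by positivity) ?_)
  obtain ⟨K, hK⟩ : ∃ K, M / 2 = K + 1 := ⟨M / 2 - 1, by omega⟩
  rw [hK, Finset.sum_range_succ', Finset.sum_range_succ', Finset.sum_eq_zero, zero_add]
  · have h1 : Real.Gamma (((2 : ℕ) : ℝ) / 2 - ((0 : ℕ) : ℝ) + 1) = 1 := by norm_num
    have h2 : Real.Gamma (((2 : ℕ) : ℝ) / 2 + ((0 : ℕ) : ℝ) + 1) = 1 := by norm_num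
    have h3 : Real.Gamma (((2 : ℕ) : ℝ) / 2 - ((0 + 1 : ℕ) : ℝ) + 1) = 1 := by norm_num
    have h4 : Real.Gamma (((2 : ℕ) : ℝ) / 2 + ((0 + 1 : ℕ) : ℝ) + 1) = 2 := by
      rw [show ((2 : ℕ) : ℝ) / 2 + ((0 + 1 : ℕ) : ℝ) + 1 = 2 + 1 by norm_num,
        Real.Gamma_add_one (by norm_num), Real.Gamma_two]
      norm_num
    rw [h1, h2, h3, h4]
    have h5 : quadEps M (2 * 0) = 1 / 2 := if_pos (Or.inl rfl)
    have h6 := quadEps_mem M (2 * (0 + 1))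
    have h7 : quadEps M (2 * (0 + 1)) *
        Real.cos (2 * ((0 + 1 : ℕ) : ℝ) * (u : ℝ) * Real.pi / (M : ℝ)) ≤ 1 :=
      (mul_le_of_le_one_right h6.1 (Real.cos_le_one _)).trans h6.2
    rw [h5]
    simp only [Nat.cast_zero, mul_zero, zero_mul, zero_div, Real.cos_zero, zero_add, pow_one,
      pow_zero] at h7 ⊢
    linarith
  · intro k _
    have h : Real.Gamma (((2 : ℕ) : ℝ) / 2 - ((k + 1 + 1 : ℕ) : ℝ) + 1) = 0 := by
      rw [show ((2 : ℕ) : ℝ) / 2 - ((k + 1 + 1 : ℕ) : ℝ) + 1 = -(k : ℝ) by push_cast; ring]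
      exact Real.Gamma_neg_nat_eq_zero k
    rw [h, zero_mul, div_zero]

theorem nodeWeight_nonneg (hn3 : n ≤ 3) {j : ℕ} (hj : 1 ≤ j) (q : NodeIndex n j) :
    0 ≤ nodeWeight n j q := by
  refine Finset.prod_nonneg fun i _ => ?_
  have hi := i.2
  rcases (by omega : n - 1 - (i : ℕ) = 1 ∨ n - 1 - (i : ℕ) = 2) with h | h <;> rw [h]
  · exact quadWeight_one_nonneg _ _
  · refine quadWeight_two_nonneg ?_ _
    calc 2 = 2 ^ 1 := rfl
      _ ≤ 2 ^ j := Nat.pow_le_pow_right (by norm_num) hj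

end

section

variable {n : ℕ}

/-! ### Expansions, samples and energy -/

theorem sInner_smul_left (f g : Sph n → ℂ) (c : ℂ) :
    sInner n (c • f) g = (starRingEnd ℂ) c * sInner n f g := by
  rw [← sInner_conj_symm, sInner_smul_right, map_mul, sInner_conj_symm]

theorem sNorm_smul (hn : 2 ≤ n) (f : Sph n → ℂ) (c : ℝ) :
    sNorm n ((c : ℂ) • f) ^ 2 = c ^ 2 * sNorm n f ^ 2 := by
  have h := sInner_self hn ((c : ℂ) • f)
  rw [sInner_smul_left, sInner_smul_right, sInner_self hn, Complex.conj_ofReal,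
    ← Complex.ofReal_mul, ← Complex.ofReal_mul, Complex.ofReal_inj] at h
  rw [← h]
  ring

theorem sNorm_add_sq (hn : 2 ≤ n) {f g : Sph n → ℂ} (hf : Continuous f) (hg : Continuous g)
    (h : sInner n f g = 0) : sNorm n (f + g) ^ 2 = sNorm n f ^ 2 + sNorm n g ^ 2 := by
  have h1 := sInner_self hn (f + g)
  have h2 : sInner n (f + g) f = sInner n f f := by
    rw [← sInner_conj_symm, sInner_add_right hf hf hg, h, add_zero, sInner_conj_symm]
  have h3 : sInner n (f + g) g = sInner n g g := by
    rw [← sInner_conj_symm, sInner_add_right hg hf hg, ← sInner_conj_symm f g, h, map_zero,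
      zero_add, sInner_conj_symm]
  rw [sInner_add_right (hf.add hg) hf hg, h2, h3, sInner_self hn, sInner_self hn,
    ← Complex.ofReal_add, Complex.ofReal_inj] at h1
  exact h1.symm

theorem eq_sum_of_orthonormal {l N : ℕ} {Y : Fin N → Sph n → ℂ}
    (hY : ∀ i i', sInner n (Y i) (Y i') = if i = i' then 1 else 0)
    (hspan : Submodule.span ℂ (Set.range Y) = harmonics n l) {f : Sph n → ℂ}
    (hf : f ∈ harmonics n l) : f = ∑ i, sInner n (Y i) f • Y i := by
  have hmem : ∀ i, Y i ∈ harmonics n l := fun i => hspan ▸ Submodule.subset_span ⟨i, rfl⟩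
  rw [← hspan, Submodule.mem_span_range_iff_exists_fun] at hf
  obtain ⟨c, rfl⟩ := hf
  refine Finset.sum_congr rfl fun i _ => ?_
  rw [sInner_sum_right _ (continuous_of_mem_harmonics (hmem i)) fun i' _ =>
    continuous_of_mem_harmonics (Submodule.smul_mem _ _ (hmem i'))]
  simp [sInner_smul_right, hY]

open MvPolynomial in
theorem exists_polynomial_of_mem_samplingSpace {j : ℕ} {f : Sph n → ℂ}
    (hf : f ∈ samplingSpace n j) : ∃ p : MvPolynomial (Fin (n + 1)) ℂ,
      p.totalDegree ≤ 2 ^ (j - 1) ∧ restrictSphere n p = f := by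
  obtain ⟨g, hg, rfl⟩ := exists_eq_sum_of_mem_samplingSpace hf
  choose p hp _ hpg using fun l => mem_harmonics.1 (hg l)
  refine ⟨∑ l ∈ Finset.range (2 ^ (j - 1)), p l, ?_, ?_⟩
  · refine totalDegree_finsetSum_le fun l hl => ?_
    exact (hp l).totalDegree_le.trans (Finset.mem_range.1 hl).le
  · rw [map_sum]
    exact Finset.sum_congr rfl fun l _ => hpg l

open MvPolynomial in
/-- The quadrature evaluates the scalar product of two functions of the sampling space. -/
theorem sum_nodes_conj_mul (hn : 2 ≤ n) {j : ℕ} (hj : 1 ≤ j) {f g : Sph n → ℂ}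
    (hf : f ∈ samplingSpace n j) (hg : g ∈ samplingSpace n j) :
    ∑ q : NodeIndex n j, (nodeWeight n j q : ℂ) * ((Real.pi / 2 ^ j : ℝ) *
      ((starRingEnd ℂ) (f (node n j q)) * g (node n j q))) = sphereArea n * sInner n f g := by
  obtain ⟨p, hp, rfl⟩ := exists_polynomial_of_mem_samplingSpace hf
  obtain ⟨r, hr, rfl⟩ := exists_polynomial_of_mem_samplingSpace hg
  have hdeg : (map (starRingEnd ℂ) p * r).totalDegree ≤ 2 ^ j := by
    have h1 : 2 ^ j = 2 ^ (j - 1) + 2 ^ (j - 1) := by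
      rw [← two_mul, ← pow_succ', Nat.sub_add_cancel hj]
    have h2 := totalDegree_mul (map (starRingEnd ℂ) p) r
    have h3 : (map (starRingEnd ℂ) p).totalDegree ≤ p.totalDegree :=
      Finset.sup_mono (support_map_subset _ _)
    omega
  have h := sum_nodes_restrictSphere hn hdeg
  simp_rw [restrictSphere_mul, restrictSphere_map_conj] at h
  rw [h, sInner, ← mul_assoc, ← Complex.ofReal_mul, mul_inv_cancel₀ (sphereArea_pos hn).ne',
    Complex.ofReal_one, one_mul]

theorem scalingFun_comm (j : ℕ) (x y : Sph n) : scalingFun n j y x = scalingFun n j x y := by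
  rw [scalingFun, scalingFun, real_inner_comm]

theorem conj_scalingFun (j : ℕ) (x y : Sph n) :
    (starRingEnd ℂ) (scalingFun n j y x) = scalingFun n j y x :=
  Complex.conj_ofReal _

theorem sqrt_two_pow_mul_self (m : ℕ) : Real.sqrt 2 ^ m * Real.sqrt 2 ^ m = 2 ^ m := by
  rw [← mul_pow, Real.mul_self_sqrt (by norm_num)]

theorem scalingFun_eq_sum_orthonormal (hn : 2 ≤ n) (j : ℕ) (y : Sph n) (N : ℕ → ℕ)
    (Y : (l : ℕ) → Fin (N l) → Sph n → ℂ)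
    (hY : ∀ l, (∀ i i', sInner n (Y l i) (Y l i') = if i = i' then 1 else 0) ∧
        Submodule.span ℂ (Set.range (Y l)) = harmonics n l) (x : Sph n) :
    scalingFun n j y x = (((Real.sqrt 2 ^ (n * j))⁻¹ : ℝ) : ℂ) *
      ∑ l ∈ Finset.range (2 ^ (j - 1)), ∑ i : Fin (N l), (starRingEnd ℂ) (Y l i y) * Y l i x := by
  rw [scalingFun_eq_sum, Finset.sum_apply, Finset.mul_sum]
  refine Finset.sum_congr rfl fun l _ => ?_
  have h := eq_sum_of_orthonormal (hY l).1 (hY l).2 (zonal_mem_harmonics l y)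
  have h1 : ∀ i, sInner n (Y l i)
      (fun x : Sph n => ((gegenbauer (lam n) l (inner ℝ x.1 y.1) : ℝ) : ℂ)) =
      ((lam n / (l + lam n) : ℝ) : ℂ) * (starRingEnd ℂ) (Y l i y) := fun i =>
    sInner_gegenbauer hn ((hY l).2 ▸ Submodule.subset_span ⟨i, rfl⟩) y
  rw [h, Pi.smul_apply, Finset.sum_apply, smul_eq_mul, Complex.ofReal_mul, mul_assoc]
  congr 1
  rw [Finset.mul_sum]
  refine Finset.sum_congr rfl fun i _ => ?_
  rw [Pi.smul_apply, smul_eq_mul, h1, ← mul_assoc, ← mul_assoc, ← Complex.ofReal_mul]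
  have h4 := lam_pos hn
  have h5 : (l : ℝ) + lam n ≠ 0 := by positivity
  rw [show ((l : ℝ) + lam n) / lam n * (lam n / (l + lam n)) = 1 by field_simp]
  simp

theorem sNorm_scalingFun_sq (hn : 2 ≤ n) (j : ℕ) (y : Sph n) :
    sNorm n (scalingFun n j y) ^ 2 = (Real.sqrt 2 ^ (n * j))⁻¹ * scalingKernel n j 1 := by
  have h := sInner_scalingFun hn (scalingFun_mem j y) y
  rw [sInner_self hn, scalingFun, real_inner_self_eq_norm_sq, norm_eq_of_mem_sphere, one_pow,
    ← Complex.ofReal_mul, Complex.ofReal_inj] at h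
  exact h

/-- By the reproducing property, the functions of the sampling space with value `1` at `y` are
those which differ from the normalized scaling function by a function orthogonal to it. -/
theorem isLeast_sNorm (hn : 2 ≤ n) {j : ℕ} (hj : 1 ≤ j) (y : Sph n) :
    IsLeast {r : ℝ | ∃ f ∈ samplingSpace n j, f y = 1 ∧ sNorm n f = r}
      (sNorm n (scalingFun n j y) / scalingKernel n j (inner ℝ y.1 y.1)) := by
  rw [real_inner_self_eq_norm_sq, norm_eq_of_mem_sphere, one_pow]
  have hK := scalingKernel_one_pos hn hj
  set K := scalingKernel n j 1 with hKdef
  set g : Sph n → ℂ := ((K⁻¹ : ℝ) : ℂ) • scalingFun n j y with hg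
  have hgV : g ∈ samplingSpace n j := Submodule.smul_mem _ _ (scalingFun_mem j y)
  have hgy : g y = 1 := by
    have h1 : scalingFun n j y y = (K : ℂ) := by
      rw [scalingFun, real_inner_self_eq_norm_sq, norm_eq_of_mem_sphere, one_pow]
    rw [hg, Pi.smul_apply, smul_eq_mul, h1, ← Complex.ofReal_mul, inv_mul_cancel₀ hK.ne',
      Complex.ofReal_one]
  have hgn : sNorm n g = sNorm n (scalingFun n j y) / K := by
    rw [← sq_eq_sq₀ (sNorm_nonneg _) (div_nonneg (sNorm_nonneg _) hK.le), hg, sNorm_smul hn]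
    field_simp
  refine ⟨⟨g, hgV, hgy, hgn⟩, ?_⟩
  rintro r ⟨f, hf, hfy, rfl⟩
  have hdiff : f - g ∈ samplingSpace n j := Submodule.sub_mem _ hf hgV
  have horth : sInner n g (f - g) = 0 := by
    rw [hg, sInner_smul_left, ← hg, sInner_scalingFun hn hdiff, Pi.sub_apply, hfy, hgy, sub_self,
      mul_zero, mul_zero]
  have h := sNorm_add_sq hn (continuous_of_mem_samplingSpace hgV)
    (continuous_of_mem_samplingSpace hdiff) horth
  rw [add_sub_cancel] at h
  rw [← hgn]
  exact abs_le_of_sq_le_sq' (by nlinarith [sq_nonneg (sNorm n (f - g))]) (sNorm_nonneg f) |>.2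

theorem eq_sum_samples (hn : 2 ≤ n) {j : ℕ} (hj : 1 ≤ j) {f : Sph n → ℂ}
    (hf : f ∈ samplingSpace n j) (x : Sph n) :
    f x = ((Real.sqrt 2 ^ (j * (n - 2)) * Real.pi / sphereArea n : ℝ) : ℂ) *
      ∑ q : NodeIndex n j, (nodeWeight n j q : ℂ) * f (node n j q) *
        scalingFun n j (node n j q) x := by
  have h := sum_nodes_conj_mul hn hj (scalingFun_mem j x) hf
  rw [sInner_scalingFun hn hf] at h
  have hA := (sphereArea_pos hn).ne'
  have h2 : (0 : ℝ) < Real.sqrt 2 := Real.sqrt_pos.2 (by norm_num)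
  have h3 : Real.sqrt 2 ^ (n * j) = Real.sqrt 2 ^ (j * (n - 2)) * 2 ^ j := by
    rw [← sqrt_two_pow_mul_self j, ← pow_add, ← pow_add]
    congr 1
    obtain ⟨m, rfl⟩ := Nat.exists_eq_add_of_le hn
    rw [Nat.add_sub_cancel_left]
    ring
  have h4 : ∑ q : NodeIndex n j, (nodeWeight n j q : ℂ) * ((Real.pi / 2 ^ j : ℝ) *
      ((starRingEnd ℂ) (scalingFun n j x (node n j q)) * f (node n j q))) =
      ((Real.pi / 2 ^ j : ℝ) : ℂ) * ∑ q : NodeIndex n j, (nodeWeight n j q : ℂ) *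
        f (node n j q) * scalingFun n j (node n j q) x := by
    rw [Finset.mul_sum]
    refine Finset.sum_congr rfl fun q _ => ?_
    rw [conj_scalingFun, scalingFun_comm]
    ring
  rw [h4] at h
  generalize ∑ q : NodeIndex n j, (nodeWeight n j q : ℂ) * f (node n j q) *
        scalingFun n j (node n j q) x = T at *
  have h5 : f x = ((Real.sqrt 2 ^ (n * j) / sphereArea n : ℝ) : ℂ) *
      ((sphereArea n : ℂ) * ((((Real.sqrt 2 ^ (n * j))⁻¹ : ℝ) : ℂ) * f x)) := by
    rw [← mul_assoc, ← mul_assoc, ← Complex.ofReal_mul, ← Complex.ofReal_mul]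
    rw [show Real.sqrt 2 ^ (n * j) / sphereArea n * sphereArea n * (Real.sqrt 2 ^ (n * j))⁻¹ = 1 by
      field_simp]
    simp
  rw [h5, ← h, h3, ← mul_assoc, ← Complex.ofReal_mul]
  congr 2
  field_simp

theorem span_scalingFun (hn : 2 ≤ n) {j : ℕ} (hj : 1 ≤ j) :
    Submodule.span ℂ (Set.range fun q : NodeIndex n j => scalingFun n j (node n j q)) =
      samplingSpace n j := by
  refine le_antisymm (Submodule.span_le.2 ?_) fun f hf => ?_
  · rintro _ ⟨q, rfl⟩
    exact scalingFun_mem j _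
  · have h : f = ((Real.sqrt 2 ^ (j * (n - 2)) * Real.pi / sphereArea n : ℝ) : ℂ) •
        ∑ q : NodeIndex n j, ((nodeWeight n j q : ℂ) * f (node n j q)) •
          scalingFun n j (node n j q) := by
      funext x
      rw [eq_sum_samples hn hj hf x, Pi.smul_apply, Finset.sum_apply, smul_eq_mul]
      rfl
    rw [h]
    exact Submodule.smul_mem _ _ (Submodule.sum_mem _ fun q _ => Submodule.smul_mem _ _
      (Submodule.subset_span ⟨q, rfl⟩))

theorem norm_sInner_scalingFun_sq (hn : 2 ≤ n) {j : ℕ} {f : Sph n → ℂ}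
    (hf : f ∈ samplingSpace n j) (y : Sph n) :
    ‖sInner n f (scalingFun n j y)‖ ^ 2 = (2 ^ (n * j))⁻¹ * ‖f y‖ ^ 2 := by
  rw [← sInner_conj_symm, sInner_scalingFun hn hf, RCLike.norm_conj, norm_mul, mul_pow,
    Complex.norm_real, Real.norm_of_nonneg (by positivity), inv_pow, sq, sqrt_two_pow_mul_self]

theorem sum_nodeWeight_mul_norm_sInner_sq (hn : 2 ≤ n) {j : ℕ} (hj : 1 ≤ j) {f : Sph n → ℂ}
    (hf : f ∈ samplingSpace n j) :
    2 ^ ((n - 1) * j) * Real.pi / sphereArea n *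
      ∑ q : NodeIndex n j, nodeWeight n j q * ‖sInner n f (scalingFun n j (node n j q))‖ ^ 2 =
      sNorm n f ^ 2 := by
  have h := sum_nodes_conj_mul hn hj hf hf
  rw [sInner_self hn] at h
  have h1 : ∀ q, (starRingEnd ℂ) (f (node n j q)) * f (node n j q) =
      ((‖f (node n j q)‖ ^ 2 : ℝ) : ℂ) := fun q => by
    rw [← Complex.normSq_eq_conj_mul_self, Complex.normSq_eq_norm_sq]
  simp_rw [h1, ← Complex.ofReal_mul] at h
  rw [← Complex.ofReal_sum, Complex.ofReal_inj] at h
  have hA := (sphereArea_pos hn).ne'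
  have h2 : ∑ q : NodeIndex n j, nodeWeight n j q *
      ‖sInner n f (scalingFun n j (node n j q))‖ ^ 2 =
      2 ^ j / Real.pi * (2 ^ (n * j))⁻¹ * ∑ q : NodeIndex n j,
        nodeWeight n j q * (Real.pi / 2 ^ j * ‖f (node n j q)‖ ^ 2) := by
    rw [Finset.mul_sum]
    refine Finset.sum_congr rfl fun q _ => ?_
    rw [norm_sInner_scalingFun_sq hn hf]
    field_simp
  have h3 : (2 : ℝ) ^ (n * j) = 2 ^ ((n - 1) * j) * 2 ^ j := by
    rw [← pow_add]
    congr 1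
    obtain ⟨m, rfl⟩ : ∃ m, n = m + 1 := ⟨n - 1, by omega⟩
    rw [Nat.add_sub_cancel]
    ring
  rw [h2, h, h3]
  field_simp

theorem isTightFrame_scalingFun (hn : 2 ≤ n) {j : ℕ} (hj : 1 ≤ j)
    (hw : ∀ q : NodeIndex n j, 0 ≤ nodeWeight n j q) :
    IsTightFrame n (samplingSpace n j)
      (fun q : NodeIndex n j => fun x =>
        (Real.sqrt (nodeWeight n j q) : ℂ) * scalingFun n j (node n j q) x)
      (sphereArea n / (2 ^ ((n - 1) * j) * Real.pi)) := by
  have hA := sphereArea_pos hn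
  refine ⟨by positivity, fun q => Submodule.smul_mem _ _ (scalingFun_mem j _), fun f hf => ?_⟩
  rw [← sum_nodeWeight_mul_norm_sInner_sq hn hj hf, ← mul_assoc]
  have h1 : sphereArea n / (2 ^ ((n - 1) * j) * Real.pi) *
      (2 ^ ((n - 1) * j) * Real.pi / sphereArea n) = 1 := by field_simp
  rw [h1, one_mul]
  refine Finset.sum_congr rfl fun q _ => ?_
  have h2 := sInner_smul_right f (scalingFun n j (node n j q)) (Real.sqrt (nodeWeight n j q) : ℂ)
  calc _ = ‖sInner n f ((Real.sqrt (nodeWeight n j q) : ℂ) •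
          scalingFun n j (node n j q))‖ ^ 2 := rfl
    _ = _ := by
      rw [h2, norm_mul, mul_pow, Complex.norm_real, Real.norm_of_nonneg (Real.sqrt_nonneg _),
        Real.sq_sqrt (hw q)]

open MvPolynomial in
theorem one_mem_harmonics : (fun _ => 1 : Sph n → ℂ) ∈ harmonics n 0 :=
  mem_harmonics.2 ⟨1, isHomogeneous_one _ _, by simp [laplacian_apply], by
    funext x
    simp [restrictSphere_apply]⟩

theorem integral_scalingFun (hn : 2 ≤ n) (j : ℕ) (y : Sph n) :
    ∫ x, scalingFun n j y x ∂(sigma n) =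
      ((sphereArea n * (Real.sqrt 2 ^ (n * j))⁻¹ : ℝ) : ℂ) := by
  have h := sInner_scalingFun hn
    (harmonics_le_samplingSpace (j := j) (by positivity) one_mem_harmonics) y
  rw [sInner] at h
  simp_rw [conj_scalingFun, mul_one] at h
  rw [Complex.ofReal_mul, ← h, ← mul_assoc, ← Complex.ofReal_mul,
    mul_inv_cancel₀ (sphereArea_pos hn).ne', Complex.ofReal_one, one_mul]

theorem sphereArea_mul_inv_sqrt_two_pow (hn : 2 ≤ n) (j : ℕ) :
    sphereArea n * (Real.sqrt 2 ^ (n * j))⁻¹ =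
      (2 : ℝ) ^ (3 - (n : ℝ) * (1 + (j : ℝ) / 2)) * Real.pi ^ ((n : ℝ) / 2 + 1) *
          Real.Gamma (2 * lam n) /
        (Real.Gamma (lam n) * Real.Gamma (lam n + 1 / 2) * Real.Gamma (lam n + 1)) := by
  have hpi := Real.pi_pos
  have hlam := lam_pos hn
  have h1 := Real.Gamma_pos_of_pos (s := 2 * lam n) (by positivity)
  have h2 := Real.Gamma_pos_of_pos (s := lam n + 1) (by positivity)
  have h3 : (Real.sqrt 2 ^ (n * j))⁻¹ = (2 : ℝ) ^ (-((n : ℝ) * j / 2)) := by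
    rw [Real.sqrt_eq_rpow, ← Real.rpow_natCast, ← Real.rpow_mul (by norm_num),
      ← Real.rpow_neg (by norm_num)]
    congr 1
    push_cast
    ring
  have h4 : (2 : ℝ) ^ (3 - (n : ℝ) * (1 + (j : ℝ) / 2)) =
      2 * (2 : ℝ) ^ (1 - 2 * lam n) * (2 : ℝ) ^ (-((n : ℝ) * j / 2)) := by
    conv_rhs => rw [← Real.rpow_one 2, ← Real.rpow_mul (by norm_num),
      ← Real.rpow_mul (by norm_num), ← Real.rpow_add (by norm_num), ← Real.rpow_add (by norm_num)]
    congr 1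
    unfold lam
    ring
  have h5 : Real.pi ^ ((n : ℝ) / 2 + 1) = Real.pi ^ (lam n + 1) * Real.sqrt Real.pi := by
    rw [Real.sqrt_eq_rpow, ← Real.rpow_add hpi]
    congr 1
    unfold lam
    ring
  have h6 := Real.sqrt_pos.2 hpi
  have h7 : (0 : ℝ) < (2 : ℝ) ^ (1 - 2 * lam n) := Real.rpow_pos_of_pos (by norm_num) _
  rw [Real.Gamma_mul_Gamma_add_half, h3, h4, h5, sphereArea]
  field_simp

theorem harmonicCoeff_scalingFun (hn : 2 ≤ n) (j : ℕ) (y : Sph n) (k : HarmonicIndex n) :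
    harmonicCoeff n hn k (scalingFun n j y) =
      if k.degree hn < 2 ^ (j - 1) then
        (((Real.sqrt 2 ^ (n * j))⁻¹ : ℝ) : ℂ) * (starRingEnd ℂ) (harmonicY n hn k y)
      else 0 :=
  sInner_harmonics_scalingFun hn (harmonicY_mem_harmonics hn k) y

theorem harmonicCoeff_scalingFun_two_scale (hn : 2 ≤ n) (j : ℕ) (y : Sph n) (k : HarmonicIndex n) :
    harmonicCoeff n hn k (scalingFun n j y) =
      if k.degree hn < 2 ^ (j - 1) then
        ((Real.sqrt 2 ^ n : ℝ) : ℂ) * harmonicCoeff n hn k (scalingFun n (j + 1) y)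
      else 0 := by
  rw [harmonicCoeff_scalingFun, harmonicCoeff_scalingFun]
  split_ifs with h h'
  · rw [← mul_assoc, ← Complex.ofReal_mul]
    congr 2
    rw [mul_add, mul_one, pow_add]
    field_simp
  · exact absurd (h.trans_le (Nat.pow_le_pow_right (by norm_num) (by omega))) h'
  · rfl

end

end SphereWavelet

open SphereWavelet
theorem mainTheorem1 (n j : ℕ) (hn : 2 ≤ n) (hj : 1 ≤ j) (p : NodeIndex n j) :
    -- expansion in any orthonormal basis of hyperspherical harmonics
    (∀ (N : ℕ → ℕ) (Y : (l : ℕ) → Fin (N l) → Sph n → ℂ),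
      (∀ l, (∀ i i', sInner n (Y l i) (Y l i') = if i = i' then 1 else 0) ∧
        Submodule.span ℂ (Set.range (Y l)) = harmonics n l) →
      ∀ x, scalingFun n j (node n j p) x =
        (((Real.sqrt 2 ^ (n * j))⁻¹ : ℝ) : ℂ) * ∑ l ∈ Finset.range (2 ^ (j - 1)), ∑ i : Fin (N l),
          (starRingEnd ℂ) (Y l i (node n j p)) * Y l i x) ∧
    -- 1. real values
    (∀ x, (scalingFun n j (node n j p) x).im = 0) ∧
    -- 2. reproducing property
    (∀ f ∈ samplingSpace n j,
      sInner n (scalingFun n j (node n j p)) f =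
        (((Real.sqrt 2 ^ (n * j))⁻¹ : ℝ) : ℂ) * f (node n j p)) ∧
    -- 3. norm
    (sNorm n (scalingFun n j (node n j p)) ^ 2 =
        (Real.sqrt 2 ^ (n * j))⁻¹ * scalingKernel n j 1 ∧
      (Real.sqrt 2 ^ (n * j))⁻¹ * scalingKernel n j 1 =
        ((n + 2 ^ j - 2 : ℕ) : ℝ) * ((n + 2 ^ (j - 1) - 2).factorial : ℝ) /
          (2 ^ (n * j) * (n.factorial : ℝ) * ((2 ^ (j - 1) - 1).factorial : ℝ))) ∧
    -- 4. localization
    IsLeast {r : ℝ | ∃ f ∈ samplingSpace n j, f (node n j p) = 1 ∧ sNorm n f = r}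
      (sNorm n (scalingFun n j (node n j p)) /
        scalingKernel n j (inner ℝ (node n j p).1 (node n j p).1)) ∧
    -- 5. spanning and reconstruction from samples
    (Submodule.span ℂ (Set.range fun q : NodeIndex n j => scalingFun n j (node n j q)) =
        samplingSpace n j ∧
      ∀ f ∈ samplingSpace n j, ∀ x,
        f x = ((Real.sqrt 2 ^ (j * (n - 2)) * Real.pi / sphereArea n : ℝ) : ℂ) *
          ∑ q : NodeIndex n j, (nodeWeight n j q : ℂ) * f (node n j q) *
            scalingFun n j (node n j q) x) ∧
    -- 6. weighted tight frame; genuine tight frame whenever the weights have real square roots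
    ((∀ f ∈ samplingSpace n j,
        2 ^ ((n - 1) * j) * Real.pi / sphereArea n *
          ∑ q : NodeIndex n j,
            nodeWeight n j q * ‖sInner n f (scalingFun n j (node n j q))‖ ^ 2 =
          sNorm n f ^ 2) ∧
      (n ≤ 3 → ∀ q : NodeIndex n j, 0 ≤ nodeWeight n j q) ∧
      ((∀ q : NodeIndex n j, 0 ≤ nodeWeight n j q) →
        IsTightFrame n (samplingSpace n j)
          (fun q : NodeIndex n j => fun x =>
            (Real.sqrt (nodeWeight n j q) : ℂ) * scalingFun n j (node n j q) x)
          (sphereArea n / (2 ^ ((n - 1) * j) * Real.pi)))) ∧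
    -- 7. Fourier coefficients and two-scale relation
    (∀ k : HarmonicIndex n,
      harmonicCoeff n hn k (scalingFun n j (node n j p)) =
        (if k.degree hn < 2 ^ (j - 1) then
          (((Real.sqrt 2 ^ (n * j))⁻¹ : ℝ) : ℂ) *
            (starRingEnd ℂ) (harmonicY n hn k (node n j p))
        else 0) ∧
      harmonicCoeff n hn k (scalingFun n j (node n j p)) =
        (if k.degree hn < 2 ^ (j - 1) then
          ((Real.sqrt 2 ^ n : ℝ) : ℂ) *
            harmonicCoeff n hn k (scalingFun n (j + 1) (node n j p))
        else 0)) ∧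
    -- 8. integral
    ∫ x, scalingFun n j (node n j p) x ∂(sigma n) =
      (((2 : ℝ) ^ (3 - (n : ℝ) * (1 + (j : ℝ) / 2)) * Real.pi ^ ((n : ℝ) / 2 + 1) *
          Real.Gamma (2 * lam n) /
        (Real.Gamma (lam n) * Real.Gamma (lam n + 1 / 2) * Real.Gamma (lam n + 1)) : ℝ) : ℂ) := by
  refine ⟨fun N Y hY x => scalingFun_eq_sum_orthonormal hn j _ N Y hY x,
    fun x => Complex.ofReal_im _, fun f hf => sInner_scalingFun hn hf _,
    ⟨sNorm_scalingFun_sq hn j _, ?_⟩, isLeast_sNorm hn hj _,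
    ⟨span_scalingFun hn hj, fun f hf x => eq_sum_samples hn hj hf x⟩,
    ⟨fun f hf => sum_nodeWeight_mul_norm_sInner_sq hn hj hf, fun hn3 => nodeWeight_nonneg hn3 hj,
      isTightFrame_scalingFun hn hj⟩,
    fun k => ⟨harmonicCoeff_scalingFun hn j _ k, harmonicCoeff_scalingFun_two_scale hn j _ k⟩, ?_⟩
  · rw [scalingKernel_one hn hj, ← mul_assoc, ← mul_inv, sqrt_two_pow_mul_self]
    field_simp
  · rw [integral_scalingFun hn, sphereArea_mul_inv_sqrt_two_pow hn]
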